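/- Theorem 1 (Zero-knowledge no-go). Let $d\ge 1$ and let $\mu$ be the uniform probability measure on the pure states of $\mathbb{C}^d$. Bob holds one system $Q_{\rm B}$ in a pure state $\eta$ distributed according to $\mu$. A (relativistic) protocol for knowledge-concealing evidencing of knowledge about a quantum state (KCEKQS), with abort option, consists of finitely many prescribed operations by agents of Alice and of Bob at given points of Minkowski space-time. The operations are general quantum instruments, possibly probabilistic, on finite-dimensional quantum systems, controlled by and producing classical data. Each acts only on systems and data in the agent's possession; systems and data are carried between agents of the same party, or sent as messages to the other party, no faster than light. One of Bob's agents receives $Q_{\rm B}$ at a given space-time point. Alice's operations depend (measurably) on the classical description of $\eta$. At the end the outcome is $1$ (Bob accepts), $0$ (Bob rejects) or "abort". Define: * $1-\epsilon_{\rm C}$ is the probability of outcome $1$, averaged over $\eta\sim\mu$, when both parties are honest and Alice knows $\eta$; * $\epsilon_{\rm S}$ is the supremum, over all strategies allowed by relativistic causality for an Alice who has no classical or quantum information about $\eta$, of the probability of outcome $1$ when Bob is honest, averaged over $\eta\sim\mu$; * $\epsilon_{\rm K}$ is the supremum, over all strategies allowed by relativistic causality for Bob, when Alice knows $\eta$ and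 is honest, of the expected squared fidelity $|\langle\eta'|\eta\rangle|^2$ of Bob's final guess $\eta'$ with $\eta$, averaged over $\eta\sim\mu$; * $\epsilon_{\rm M}$ is the supremum, over all measurements on the single copy of $\eta$ followed by a guess $\eta'$, of the same expected squared fidelity. The protocol is non-trivial if $1-\epsilon_{\rm C}>\epsilon_{\rm S}$, and zero-knowledge if $\epsilon_{\rm K}=\epsilon_{\rm M}$. Then no non-trivial KCEKQS protocol is zero-knowledge: every non-trivial KCEKQS protocol has $\epsilon_{\rm K}>\epsilon_{\rm M}$. -/

import Mathlib

open MeasureTheory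
open scoped ENNReal ComplexOrder

noncomputable section

namespace KCEKQS

/-! ### Pure states of a qudit and the uniform measure -/

/-- Unit vectors of the `d`-dimensional Hilbert space of the system held by Bob. -/
abbrev UnitVector (d : ℕ) : Type := Metric.sphere (0 : EuclideanSpace ℂ (Fin d)) 1

/-- The uniform (rotation invariant, normalised surface) measure on unit vectors.  Everything below
depends on a vector only through its ray, so this is the uniform measure on pure states. -/
def uniform (d : ℕ) : Measure (UnitVector d) :=
  ((Measure.addHaar : Measure (EuclideanSpace ℂ (Fin d))).toSphere Set.univ)⁻¹ •
    (Measure.addHaar : Measure (EuclideanSpace ℂ (Fin d))).toSphere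

/-- The rank-one projector `|v⟩⟨v|`. -/
def projector {d : ℕ} (v : UnitVector d) : Fin d → Fin d → ℂ :=
  fun i j => v.1 i * star (v.1 j)

/-- The classical description of a pure state: a rank-one projector.  The global phase of a state
vector is not part of it. -/
abbrev PureState (d : ℕ) : Type :=
  {ρ : Fin d → Fin d → ℂ // ∃ v : UnitVector d, projector v = ρ}

/-- The pure state given by a unit vector. -/
def toPure {d : ℕ} (v : UnitVector d) : PureState d := ⟨projector v, v, rfl⟩

/-- The squared fidelity `|⟨v, w⟩|²` of two pure states. -/
def fidelity {d : ℕ} (v w : UnitVector d) : ℝ≥0∞ := ‖inner ℂ v.1 w.1‖ₑ ^ 2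

/-! ### Estimation of the state from the single copy -/

/-- A way to estimate an unknown pure state from one copy: a measurement (a POVM with density `povm`
with respect to the measure `μ` on the outcome space) and a guess for each outcome. -/
structure Estimator (d : ℕ) where
  Out : Type
  [instOut : MeasurableSpace Out]
  μ : Measure Out
  [sigmaFinite : SigmaFinite μ]
  povm : Out → Matrix (Fin d) (Fin d) ℂ
  measurable_povm : ∀ i j, Measurable fun ω => povm ω i j
  posSemidef : ∀ ω, (povm ω).PosSemidef
  total : ∀ v : Fin d → ℂ,
    ∫⁻ ω, ENNReal.ofReal (dotProduct (star v) ((povm ω).mulVec v)).re ∂μ = ∑ i, ‖v i‖ₑ ^ 2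
  guess : Out → UnitVector d
  measurable_guess : Measurable guess

attribute [instance] Estimator.instOut Estimator.sigmaFinite

/-- The expected squared fidelity of the guess, for a uniformly random state. -/
def Estimator.score {d : ℕ} (E : Estimator d) : ℝ≥0∞ :=
  ∫⁻ η : UnitVector d, ∫⁻ ω,
    ENNReal.ofReal (dotProduct (star ⇑η.1) ((E.povm ω).mulVec ⇑η.1)).re *
      fidelity (E.guess ω) η ∂E.μ ∂uniform d

/-- `ε_M`: the optimal single-copy estimation fidelity. -/
def epsilonM (d : ℕ) : ℝ≥0∞ := ⨆ E : Estimator d, E.score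

/-! ### Space-time -/

/-- Minkowski space-time: a time and a position, in units with `c = 1`. -/
abbrev Spacetime : Type := ℝ × EuclideanSpace ℝ (Fin 3)

/-- `q` lies in the closed future light cone of `p`. -/
def Precedes (p q : Spacetime) : Prop := dist p.2 q.2 ≤ q.1 - p.1

/-! ### Registers and local operations -/

/-- A finite family of registers.  Each one carries a quantum system of finite dimension (dimension
one if it is purely classical) and a classical value, encoded as a real number (every standard
Borel space embeds measurably in the reals). -/
structure Registers where
  Idx : Type
  [instFintype : Fintype Idx]
  [instDecEq : DecidableEq Idx]
  dim : Idx → ℕ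
  dim_pos : ∀ i, 0 < dim i

attribute [instance] Registers.instFintype Registers.instDecEq

/-- Labels of the product basis of the Hilbert space of all registers of the family. -/
abbrev Registers.Basis (R : Registers) : Type := ∀ i : R.Idx, Fin (R.dim i)

/-- Add one register of dimension `d`, labelled `none`; used for the system `Q_B`. -/
abbrev Registers.adjoin (d : ℕ) [NeZero d] (R : Registers) : Registers where
  Idx := Option R.Idx
  dim
    | none => d
    | some i => R.dim i
  dim_pos
    | none => NeZero.pos d
    | some i => R.dim_pos i

/-- Labels of the product basis of the registers in `S` (private) and `T` (messages). -/
abbrev LocalBasis (P M : Registers) (S : Finset P.Idx) (T : Finset M.Idx) : Type :=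
  (∀ i : S, Fin (P.dim i)) × (∀ i : T, Fin (M.dim i))

/-- The classical values held by the registers in `S` and `T`. -/
abbrev LocalData (P M : Registers) (S : Finset P.Idx) (T : Finset M.Idx) : Type :=
  (S → ℝ) × (T → ℝ)

/-- An operation that one agent carries out at one point of space-time on those registers that are
then in the agent's possession: private registers `priv` of the agent's party and message registers
`msgs`.  It is a quantum instrument controlled by the classical values `x` of these registers: an
outcome `ω` in `Out` occurs with Kraus operator `kraus c x ω` (a density with respect to `μ`, with
`∫ K† K dμ = 1`), and the classical values are replaced by `update c x ω`.  Unitary operations,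
measurements, channels and classical random choices are special cases.  The parameter `c : C` is
classical information available to the agent from the start (such as a description of a state). -/
structure LocalOp (C : Type) [MeasurableSpace C] (P M : Registers) where
  loc : Spacetime
  priv : Finset P.Idx
  msgs : Finset M.Idx
  Out : Type
  [instOut : MeasurableSpace Out]
  μ : Measure Out
  [sigmaFinite : SigmaFinite μ]
  kraus : C → LocalData P M priv msgs → Out →
    Matrix (LocalBasis P M priv msgs) (LocalBasis P M priv msgs) ℂ
  measurable_kraus : ∀ i j,
    Measurable fun p : C × LocalData P M priv msgs × Out => kraus p.1 p.2.1 p.2.2 i j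
  complete : ∀ c x (v : LocalBasis P M priv msgs → ℂ),
    ∫⁻ ω, ∑ i, ‖(kraus c x ω).mulVec v i‖ₑ ^ 2 ∂μ = ∑ i, ‖v i‖ₑ ^ 2
  update : C → LocalData P M priv msgs → Out → LocalData P M priv msgs
  measurable_update :
    Measurable fun p : C × LocalData P M priv msgs × Out => update p.1 p.2.1 p.2.2

attribute [instance] LocalOp.instOut LocalOp.sigmaFinite

namespace LocalOp

variable {C : Type} [MeasurableSpace C] {P M : Registers}

/-- The classical values seen by the operation. -/
def read (op : LocalOp C P M) (x : P.Idx → ℝ) (y : M.Idx → ℝ) : LocalData P M op.priv op.msgs :=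
  (fun i => x i, fun i => y i)

/-- The classical values of the private registers after outcome `ω`. -/
def newPriv (op : LocalOp C P M) (c : C) (ω : op.Out) (x : P.Idx → ℝ) (y : M.Idx → ℝ) :
    P.Idx → ℝ :=
  fun i => if h : i ∈ op.priv then (op.update c (op.read x y) ω).1 ⟨i, h⟩ else x i

/-- The classical values of the message registers after outcome `ω`. -/
def newMsgs (op : LocalOp C P M) (c : C) (ω : op.Out) (x : P.Idx → ℝ) (y : M.Idx → ℝ) :
    M.Idx → ℝ :=
  fun i => if h : i ∈ op.msgs then (op.update c (op.read x y) ω).2 ⟨i, h⟩ else y i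

/-- Matrix entry of `K ⊗ 1`, where `K` acts on the registers of the operation and `1` is the
identity on the other private and message registers. -/
def lift (op : LocalOp C P M)
    (K : Matrix (LocalBasis P M op.priv op.msgs) (LocalBasis P M op.priv op.msgs) ℂ)
    (a : P.Basis) (m : M.Basis) (a' : P.Basis) (m' : M.Basis) : ℂ :=
  if (∀ i, i ∉ op.priv → a i = a' i) ∧ (∀ i, i ∉ op.msgs → m i = m' i) then
    K (fun i => a i, fun i => m i) (fun i => a' i, fun i => m' i)
  else 0

/-- The (unnormalised) vector after outcome `ω`; the other party's registers `Z` are spectators. -/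
def evolve {Z : Type} (op : LocalOp C P M) (c : C) (ω : op.Out) (x : P.Idx → ℝ) (y : M.Idx → ℝ)
    (ψ : P.Basis → M.Basis → Z → ℂ) : P.Basis → M.Basis → Z → ℂ :=
  fun a m z => ∑ a', ∑ m', op.lift (op.kraus c (op.read x y) ω) a m a' m' * ψ a' m' z

end LocalOp

/-! ### Runs -/

/-- The two parties. -/
inductive Party
  | alice
  | bob

/-- A step of a run: an operation by an agent of Alice's (`Sum.inl`) or of Bob's (`Sum.inr`).
Agents of Alice's have the classical information of type `C`, agents of Bob's have none. -/
abbrev Step (C : Type) [MeasurableSpace C] (A M B : Registers) : Type 1 :=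
  LocalOp C A M ⊕ LocalOp Unit B M

/-- The configuration during a run, conditional on all outcomes so far: the classical values of
Alice's private registers, of the message registers and of Bob's private registers, and the joint
state vector, whose squared norm is the probability density of these outcomes. -/
abbrev Config (A M B : Registers) : Type :=
  (A.Idx → ℝ) × (M.Idx → ℝ) × (B.Idx → ℝ) × (A.Basis → M.Basis → B.Basis → ℂ)

section Runs

variable {C : Type} [MeasurableSpace C] {A M B : Registers}

/-- Squared norm of the state vector of a configuration. -/
def Config.weight (s : Config A M B) : ℝ≥0∞ := ∑ a, ∑ m, ∑ b, ‖s.2.2.2 a m b‖ₑ ^ 2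

/-- Effect of an operation of Alice's. -/
def actAlice (op : LocalOp C A M) (c : C) (ω : op.Out) (s : Config A M B) : Config A M B :=
  (op.newPriv c ω s.1 s.2.1, op.newMsgs c ω s.1 s.2.1, s.2.2.1,
    op.evolve c ω s.1 s.2.1 s.2.2.2)

/-- Effect of an operation of Bob's. -/
def actBob (op : LocalOp Unit B M) (ω : op.Out) (s : Config A M B) : Config A M B :=
  (s.1, op.newMsgs () ω s.2.2.1 s.2.1, op.newPriv () ω s.2.2.1 s.2.1,
    fun a m b => op.evolve () ω s.2.2.1 s.2.1 (fun b' m' a' => s.2.2.2 a' m' b') b m a)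

/-- The integral of `F` of the final configuration over all outcomes of all steps. -/
def total (c : C) : List (Step C A M B) → (Config A M B → ℝ≥0∞) → Config A M B → ℝ≥0∞
  | [], F, s => F s
  | Sum.inl op :: L, F, s => ∫⁻ ω, total c L F (actAlice op c ω s) ∂op.μ
  | Sum.inr op :: L, F, s => ∫⁻ ω, total c L F (actBob op ω s) ∂op.μ

/-- The expectation of a function `f` of the final classical values of Bob's registers. -/
def expectation (c : C) (L : List (Step C A M B)) (f : (B.Idx → ℝ) → ℝ≥0∞)
    (s : Config A M B) : ℝ≥0∞ :=
  total c L (fun t => t.weight * f t.2.2.1) s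

/-- `s` may come before `t`: a register touched by both is carried from the one point to the other
no faster than light, and a message register passes from the party that sends it to the other party
once, and never back. -/
def Compatible (sender : M.Idx → Party) : Step C A M B → Step C A M B → Prop
  | Sum.inl s, Sum.inl t =>
      (Disjoint s.priv t.priv ∧ Disjoint s.msgs t.msgs) ∨ Precedes s.loc t.loc
  | Sum.inr s, Sum.inr t =>
      (Disjoint s.priv t.priv ∧ Disjoint s.msgs t.msgs) ∨ Precedes s.loc t.loc
  | Sum.inl s, Sum.inr t =>
      ∀ m, m ∈ s.msgs → m ∈ t.msgs → sender m = Party.alice ∧ Precedes s.loc t.loc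
  | Sum.inr s, Sum.inl t =>
      ∀ m, m ∈ s.msgs → m ∈ t.msgs → sender m = Party.bob ∧ Precedes s.loc t.loc

end Runs

section Causality

variable {C : Type} [MeasurableSpace C] {A M B : Registers} {d : ℕ} [NeZero d]

/-- A list of steps that respects relativistic causality, where the system `Q_B` (the register
`none` of Bob's) is handed to an agent of Bob's at the point `source`. -/
def Causal (sender : M.Idx → Party) (source : Spacetime) (L : List (Step C A M (B.adjoin d))) :
    Prop :=
  L.Pairwise (Compatible sender) ∧
    ∀ op : LocalOp Unit (B.adjoin d) M, Sum.inr op ∈ L →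
      (none : Option B.Idx) ∈ op.priv → Precedes source op.loc

/-- The operations of Alice's in a list of steps. -/
def aliceOps (L : List (Step C A M B)) : List (LocalOp C A M) := L.filterMap Sum.getLeft?

/-- The operations of Bob's in a list of steps. -/
def bobOps (L : List (Step C A M B)) : List (LocalOp Unit B M) := L.filterMap Sum.getRight?

/-- The initial configuration: Alice's and Bob's private registers are in the states `α` and `β`,
message registers are in their first basis state, `Q_B` is in the state `ψ`, and all classical
values are zero. -/
def initial (α : A.Basis → ℂ) (β : B.Basis → ℂ) (ψ : UnitVector d) : Config A M (B.adjoin d) :=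
  (fun _ => 0, fun _ => 0, fun _ => 0, fun a m b =>
    α a * (if ∀ i, (m i : ℕ) = 0 then 1 else 0) *
      (ψ.1 (show Fin d from b (none : Option B.Idx)) *
        β (fun i => b (some i : Option B.Idx))))

end Causality

/-! ### Protocols -/

/-- The three possible outcomes of a protocol. -/
inductive Outcome
  | reject
  | accept
  | abort

/-- The outcome encoded by a classical value: `0` is reject, `1` is accept, anything else is
abort. -/
def outcomeOf (x : ℝ) : Outcome :=
  if x = 0 then Outcome.reject else if x = 1 then Outcome.accept else Outcome.abort

/-- A relativistic protocol for knowledge-concealing evidencing of knowledge about a quantum state,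
with abort option: a finite list of operations of Alice's and Bob's agents, at given points of
space-time, which communicate through message registers.  Alice's operations depend on the
classical description of a pure state.  The classical value of Bob's register `verdict` gives the
outcome at the end.  Announcements, including those of an abort, are messages. -/
structure Protocol (d : ℕ) [NeZero d] where
  A : Registers
  M : Registers
  B : Registers
  sender : M.Idx → Party
  source : Spacetime
  initA : A.Basis → ℂ
  initA_unit : ∑ a, ‖initA a‖ ^ 2 = 1
  initB : B.Basis → ℂ
  initB_unit : ∑ b, ‖initB b‖ ^ 2 = 1
  steps : List (Step (PureState d) A M (B.adjoin d))
  causal : Causal sender source steps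
  verdict : B.Idx

namespace Protocol

variable {d : ℕ} [NeZero d]

/-- `p(x | ψ; η)`: the probability of outcome `x` when `Q_B` is in the state `ψ`, Bob is honest, and
Alice acts as prescribed for the state `η`. -/
def prob (P : Protocol d) (x : Outcome) (ψ η : UnitVector d) : ℝ≥0∞ :=
  expectation (toPure η) P.steps
    (Set.indicator {y | outcomeOf (y (some P.verdict : Option P.B.Idx)) = x} 1)
    (initial P.initA P.initB ψ)

/-- `ε_C`: one minus the probability of acceptance when both parties are honest, averaged over a
uniformly random state. -/
def epsilonC (P : Protocol d) : ℝ≥0∞ := 1 - ∫⁻ η, P.prob Outcome.accept η η ∂uniform d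

/-- A strategy for a dishonest Alice who has no information about the state.  Her agents may carry
out any operations on any registers of hers, anywhere in space-time, and send any messages. -/
structure AliceStrategy (P : Protocol d) where
  A : Registers
  init : A.Basis → ℂ
  init_unit : ∑ a, ‖init a‖ ^ 2 = 1
  steps : List (Step Unit A P.M (P.B.adjoin d))
  causal : Causal P.sender P.source steps
  honestBob : bobOps steps = bobOps P.steps

/-- The probability of acceptance, averaged over a uniformly random state. -/
def AliceStrategy.score {P : Protocol d} (σ : P.AliceStrategy) : ℝ≥0∞ :=
  ∫⁻ η, expectation () σ.steps
    (Set.indicator {y | outcomeOf (y (some P.verdict : Option P.B.Idx)) = Outcome.accept} 1)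
    (initial σ.init P.initB η) ∂uniform d

/-- `ε_S`: the optimal probability of acceptance for an Alice who knows nothing about the state. -/
def epsilonS (P : Protocol d) : ℝ≥0∞ := ⨆ σ : P.AliceStrategy, σ.score

/-- A strategy for a dishonest Bob against honest Alice.  His agents may carry out any operations on
`Q_B` and on any registers of his, anywhere in space-time, and send any messages.  At the end he
guesses the state from the classical values in his registers. -/
structure BobStrategy (P : Protocol d) where
  B : Registers
  init : B.Basis → ℂ
  init_unit : ∑ b, ‖init b‖ ^ 2 = 1
  steps : List (Step (PureState d) P.A P.M (B.adjoin d))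
  causal : Causal P.sender P.source steps
  honestAlice : aliceOps steps = aliceOps P.steps
  guess : (Option B.Idx → ℝ) → UnitVector d
  measurable_guess : Measurable guess

/-- The expected squared fidelity of Bob's guess, for a uniformly random state known to Alice. -/
def BobStrategy.score {P : Protocol d} (σ : P.BobStrategy) : ℝ≥0∞ :=
  ∫⁻ η, expectation (toPure η) σ.steps (fun y => fidelity (σ.guess y) η)
    (initial P.initA σ.init η) ∂uniform d

/-- `ε_K`: the optimal expected squared fidelity of Bob's guess after the protocol. -/
def epsilonK (P : Protocol d) : ℝ≥0∞ := ⨆ σ : P.BobStrategy, σ.score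

/-- A protocol is non-trivial if `1 - ε_C > ε_S`. -/
def NonTrivial (P : Protocol d) : Prop := P.epsilonS < 1 - P.epsilonC

/-- A protocol is zero-knowledge if Bob cannot estimate the state any better after the protocol than
from the single copy alone. -/
def ZeroKnowledge (P : Protocol d) : Prop := P.epsilonK = epsilonM d

end Protocol

end KCEKQS

end

namespace KCEKQS

/-! ### Fourth moments of measures on the sphere -/

section Moments

variable {d : ℕ}

/-! Let p(ψ; η) be the probability that honest Bob accepts when his system is in the state ψ and
Alice acts as prescribed for η, and let F be the squared fidelity. Since `epsilonM` is at most
2/(d+1) (`epsilonM_le`), it suffices to show that `epsilonK` ≤ 2/(d+1) forces the average of p(η; η)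
to be at most `epsilonS`.

Attack by Bob: he measures the real system in an orthonormal basis whose first vector is g, and runs
the protocol honestly on a substitute in a state ψ of his choice. He guesses the vector he found,
except that he switches from g to h when he found g and the run accepted. Without the switch the
score is exactly 2/(d+1), so the switch must not help: ∫ p(ψ; η) F(g, η) F(h, η) dη ≤ ∫ p(ψ; η) F(g,
η)² dη for all g and h (`weighted_fourth_moment_le`).

Rigidity: let ν be the uniform measure with density p(ψ; ·). A symmetric fourth-moment form
dominated by its diagonal in this way has a constant diagonal (`fourth_moment_const_of_diag_max`):
its diagonal values at g and h differ by at most a multiple of ‖g − h‖², so the derivative vanishes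
along great circles. Polarization then determines the lower moments up to the common constant, and d
∫ p(ψ; η) F(ψ, η) dη = ∫ p(ψ; η) dη (`lintegral_prob_mul_fidelity`).

Linearity: for fixed η, p(ψ; η) is a quadratic form in ψ, because the amplitudes evolve linearly
(`hasDesignIdentity_expectation`). The uniform fourth moments give d(d+1) ∫ p(ψ; η) F(ψ, η) dψ = d ∫
p(ψ; η) dψ + p(η; η). Integrating both identities over the remaining variable and comparing shows
that the average of p(η; η) equals the average of p(ψ; η) over independent ψ and η
(`lintegral_prob_diag`). The latter is what an ignorant Alice reaches by pretending that the state
is a random η, so some fixed η does at least as well, and non-triviality fails. -/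

theorem continuous_norm_inner_sphere (a : EuclideanSpace ℂ (Fin d)) :
    Continuous fun η : UnitVector d => ‖inner ℂ a η.1‖ := by
  fun_prop

theorem integrable_of_continuous_sphere {f : UnitVector d → ℝ} (hf : Continuous f)
    (ν : Measure (UnitVector d)) [IsFiniteMeasure ν] : Integrable f ν :=
  hf.integrable_of_hasCompactSupport (HasCompactSupport.of_compactSpace f)

/-- Averaging |z + uw|⁴ over the fourth roots of unity u kills the terms linear in Re(z̄uw) and
replaces its square by |z|²|w|²/2. -/
theorem Complex.polarize_norm_pow_four (z w : ℂ) :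
    ‖z + w‖ ^ 4 + ‖z - w‖ ^ 4 + ‖z + Complex.I * w‖ ^ 4 + ‖z - Complex.I * w‖ ^ 4 =
      4 * (‖z‖ ^ 4 + ‖w‖ ^ 4 + 4 * (‖z‖ ^ 2 * ‖w‖ ^ 2)) := by
  have h4 : ∀ u : ℂ, ‖u‖ ^ 4 = (u.re * u.re + u.im * u.im) ^ 2 := fun u => by
    rw [← Complex.normSq_apply, ← Complex.sq_norm]; ring
  have h2 : ∀ u : ℂ, ‖u‖ ^ 2 = u.re * u.re + u.im * u.im := fun u => by
    rw [← Complex.normSq_apply, ← Complex.sq_norm]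
  rw [h4, h4, h4, h4, h4, h4, h2, h2]
  simp
  ring

/-- The same average over phases, with ⟨a, b⟩ in place of z̄w; Cauchy–Schwarz need not be sharp, so
the inner product survives. -/
theorem polarize_norm_pow_four {E : Type*} [NormedAddCommGroup E] [InnerProductSpace ℂ E]
    (a b : E) :
    ‖a + b‖ ^ 4 + ‖a - b‖ ^ 4 + ‖a + Complex.I • b‖ ^ 4 + ‖a - Complex.I • b‖ ^ 4 =
      4 * ((‖a‖ ^ 2 + ‖b‖ ^ 2) ^ 2 + 2 * ‖inner ℂ a b‖ ^ 2) := by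
  have h : ∀ x : E, ‖x‖ ^ 4 = (‖x‖ ^ 2) ^ 2 := fun x => by ring
  rw [h (a + b), h (a - b), h (a + Complex.I • b), h (a - Complex.I • b),
    @norm_add_sq ℂ, @norm_sub_sq ℂ, @norm_add_sq ℂ, @norm_sub_sq ℂ, inner_smul_right, norm_smul,
    Complex.sq_norm (inner ℂ a b), Complex.normSq_apply]
  simp
  ring

/-- Polarize both sides of the hypothesis: the scalar identity with z = ⟨a, η⟩, w = ⟨b, η⟩ under the
integral, the vector identity for the norms on the right. -/
theorem integral_inner_sq_mul_inner_sq (ν : Measure (UnitVector d)) [IsFiniteMeasure ν] (c : ℝ)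
    (hc : ∀ a : EuclideanSpace ℂ (Fin d), ∫ η, ‖inner ℂ a η.1‖ ^ 4 ∂ν = c * ‖a‖ ^ 4)
    (a b : EuclideanSpace ℂ (Fin d)) :
    ∫ η, ‖inner ℂ a η.1‖ ^ 2 * ‖inner ℂ b η.1‖ ^ 2 ∂ν =
      c / 2 * (‖a‖ ^ 2 * ‖b‖ ^ 2 + ‖inner ℂ a b‖ ^ 2) := by
  have key : ∀ η : UnitVector d,
      ‖inner ℂ (a + b) η.1‖ ^ 4 + ‖inner ℂ (a - b) η.1‖ ^ 4 +
        ‖inner ℂ (a + Complex.I • b) η.1‖ ^ 4 + ‖inner ℂ (a - Complex.I • b) η.1‖ ^ 4 =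
      4 * (‖inner ℂ a η.1‖ ^ 4 + ‖inner ℂ b η.1‖ ^ 4 +
        4 * (‖inner ℂ a η.1‖ ^ 2 * ‖inner ℂ b η.1‖ ^ 2)) := by
    intro η
    rw [← Complex.polarize_norm_pow_four]
    simp only [inner_add_left, inner_sub_left, inner_smul_left, Complex.conj_I, neg_mul,
      sub_neg_eq_add, ← sub_eq_add_neg]
    ring
  have := congrArg (fun f : UnitVector d → ℝ => ∫ η, f η ∂ν) (funext key)
  rw [integral_add, integral_add, integral_add, integral_const_mul, integral_add, integral_add,
    integral_const_mul, hc, hc, hc, hc, hc, hc, ← mul_add, ← mul_add, ← mul_add,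
    polarize_norm_pow_four] at this
  · linarith
  all_goals exact integrable_of_continuous_sphere (by fun_prop) ν

/-- Parseval for the unit vector η inserts a factor 1 = ∑ |⟨eᵢ, η⟩|²; summing the mixed moments
gives d‖a‖² + ‖a‖², hence d + 1. -/
theorem integral_inner_sq (ν : Measure (UnitVector d)) [IsFiniteMeasure ν] (c : ℝ)
    (hc : ∀ a : EuclideanSpace ℂ (Fin d), ∫ η, ‖inner ℂ a η.1‖ ^ 4 ∂ν = c * ‖a‖ ^ 4)
    (a : EuclideanSpace ℂ (Fin d)) :
    ∫ η, ‖inner ℂ a η.1‖ ^ 2 ∂ν = c / 2 * (d + 1) * ‖a‖ ^ 2 := by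
  let e := EuclideanSpace.basisFun (Fin d) ℂ
  have h1 : ∀ η : UnitVector d, ‖inner ℂ a η.1‖ ^ 2 =
      ∑ i, ‖inner ℂ a η.1‖ ^ 2 * ‖inner ℂ (e i) η.1‖ ^ 2 := by
    intro η
    rw [← Finset.mul_sum, e.sum_sq_norm_inner_right η.1]
    simp
  rw [funext h1, integral_finsetSum]
  · simp_rw [integral_inner_sq_mul_inner_sq ν c hc]
    rw [← Finset.mul_sum, Finset.sum_add_distrib, e.sum_sq_norm_inner_left a]
    simp
    ring
  · intro i _
    exact integrable_of_continuous_sphere (((continuous_norm_inner_sphere _).pow 2).mul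
      ((continuous_norm_inner_sphere _).pow 2)) ν

/-- A second use of Parseval. It ties the constant c to the total mass. -/
theorem measureReal_univ_sphere (ν : Measure (UnitVector d)) [IsFiniteMeasure ν] (c : ℝ)
    (hc : ∀ a : EuclideanSpace ℂ (Fin d), ∫ η, ‖inner ℂ a η.1‖ ^ 4 ∂ν = c * ‖a‖ ^ 4) :
    ν.real Set.univ = d * (c / 2 * (d + 1)) := by
  let e := EuclideanSpace.basisFun (Fin d) ℂ
  have h1 : ∀ η : UnitVector d, (1 : ℝ) = ∑ i, ‖inner ℂ (e i) η.1‖ ^ 2 := by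
    intro η
    rw [e.sum_sq_norm_inner_right η.1]
    simp
  have h2 : ∫ _η : UnitVector d, (1 : ℝ) ∂ν = ν.real Set.univ := by simp
  rw [← h2, funext h1, integral_finsetSum]
  · simp_rw [integral_inner_sq ν c hc]
    simp
  · intro i _
    exact integrable_of_continuous_sphere ((continuous_norm_inner_sphere _).pow 2) ν

theorem integral_inner_pow_four_of_unit (ν : Measure (UnitVector d)) (c : ℝ)
    (hc : ∀ a : UnitVector d, ∫ η, ‖inner ℂ a.1 η.1‖ ^ 4 ∂ν = c)
    (a : EuclideanSpace ℂ (Fin d)) : ∫ η, ‖inner ℂ a η.1‖ ^ 4 ∂ν = c * ‖a‖ ^ 4 := by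
  by_cases ha : a = 0
  · simp [ha]
  have hn : ‖a‖ ≠ 0 := norm_ne_zero_iff.2 ha
  let u : UnitVector d := ⟨((‖a‖⁻¹ : ℝ) : ℂ) • a, by
    rw [mem_sphere_zero_iff_norm, norm_smul]; simp [hn]⟩
  have hu : a = ((‖a‖ : ℝ) : ℂ) • u.1 := by
    simp only [u, smul_smul, ← Complex.ofReal_mul, mul_inv_cancel₀ hn]; simp
  rw [hu, funext fun η : UnitVector d => congrArg (· ^ 4) (congrArg norm
    (inner_smul_left u.1 η.1 ((‖a‖ : ℝ) : ℂ)))]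
  simp only [norm_mul, mul_pow, integral_const_mul, hc, norm_smul, norm_eq_of_mem_sphere]
  simp [mul_comm]

/-- If the fourth moment form is maximised on the diagonal, then it is constant on the diagonal. -/
theorem fourth_moment_const_of_diag_max (ν : Measure (UnitVector d)) [IsFiniteMeasure ν]
    (hB : ∀ g h : UnitVector d, ∫ η, ‖inner ℂ g.1 η.1‖ ^ 2 * ‖inner ℂ h.1 η.1‖ ^ 2 ∂ν ≤
      ∫ η, ‖inner ℂ g.1 η.1‖ ^ 4 ∂ν) (g h : UnitVector d) :
    ∫ η, ‖inner ℂ g.1 η.1‖ ^ 4 ∂ν = ∫ η, ‖inner ℂ h.1 η.1‖ ^ 4 ∂ν := by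
  set q : EuclideanSpace ℂ (Fin d) → ℝ := fun a => ∫ η, ‖inner ℂ a η.1‖ ^ 4 ∂ν with hq
  have I4 : ∀ u : EuclideanSpace ℂ (Fin d),
      Integrable (fun η : UnitVector d => ‖inner ℂ u η.1‖ ^ 4) ν :=
    fun u => integrable_of_continuous_sphere ((continuous_norm_inner_sphere u).pow 4) ν
  have I22 : ∀ a b : EuclideanSpace ℂ (Fin d),
      Integrable (fun η : UnitVector d => ‖inner ℂ a η.1‖ ^ 2 * ‖inner ℂ b η.1‖ ^ 2) ν :=
    fun a b => integrable_of_continuous_sphere (((continuous_norm_inner_sphere a).pow 2).mul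
      ((continuous_norm_inner_sphere b).pow 2)) ν
  -- Integrate (|⟨a,η⟩|² − |⟨b,η⟩|²)². Expanded, this is q a + q b minus twice the mixed moment,
  -- which by `hB` is at least q a − q b; pointwise, the integrand is at most 4‖a − b‖².
  have bound : ∀ a b : EuclideanSpace ℂ (Fin d), ‖a‖ = 1 → ‖b‖ = 1 →
      q a - q b ≤ ν.real Set.univ * (4 * ‖a - b‖ ^ 2) := by
    intro a b ha hb
    have h1 := hB ⟨a, by simpa using ha⟩ ⟨b, by simpa using hb⟩
    have h2 := hB ⟨b, by simpa using hb⟩ ⟨a, by simpa using ha⟩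
    have h3 : ∫ η : UnitVector d, (‖inner ℂ a η.1‖ ^ 4 + ‖inner ℂ b η.1‖ ^ 4 -
        2 * (‖inner ℂ b η.1‖ ^ 2 * ‖inner ℂ a η.1‖ ^ 2)) ∂ν ≤
        ∫ _η : UnitVector d, 4 * ‖a - b‖ ^ 2 ∂ν := by
      refine integral_mono (((I4 _).add (I4 _)).sub ((I22 _ _).const_mul 2))
        (integrable_const _) fun η => ?_
      have e1 : ‖inner ℂ a η.1‖ ≤ 1 := by
        simpa [ha] using norm_inner_le_norm (𝕜 := ℂ) a η.1
      have e2 : ‖inner ℂ b η.1‖ ≤ 1 := by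
        simpa [hb] using norm_inner_le_norm (𝕜 := ℂ) b η.1
      have e3 : |‖inner ℂ a η.1‖ - ‖inner ℂ b η.1‖| ≤ ‖a - b‖ := by
        refine (abs_norm_sub_norm_le _ _).trans ?_
        rw [← inner_sub_left]
        simpa using norm_inner_le_norm (𝕜 := ℂ) (a - b) η.1
      have e4 : |‖inner ℂ a η.1‖ + ‖inner ℂ b η.1‖| ≤ 2 := by
        rw [abs_of_nonneg (by positivity)]; linarith
      have e5 : |(‖inner ℂ a η.1‖ - ‖inner ℂ b η.1‖) *
          (‖inner ℂ a η.1‖ + ‖inner ℂ b η.1‖)| ≤ ‖a - b‖ * 2 := by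
        rw [abs_mul]; gcongr
      calc _ = ((‖inner ℂ a η.1‖ - ‖inner ℂ b η.1‖) *
          (‖inner ℂ a η.1‖ + ‖inner ℂ b η.1‖)) ^ 2 := by ring
        _ = |(‖inner ℂ a η.1‖ - ‖inner ℂ b η.1‖) *
          (‖inner ℂ a η.1‖ + ‖inner ℂ b η.1‖)| ^ 2 := (sq_abs _).symm
        _ ≤ (‖a - b‖ * 2) ^ 2 := by gcongr
        _ = 4 * ‖a - b‖ ^ 2 := by ring
    rw [integral_sub (f := fun η : UnitVector d => ‖inner ℂ a η.1‖ ^ 4 + ‖inner ℂ b η.1‖ ^ 4)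
      ((I4 _).add (I4 _)) ((I22 _ _).const_mul 2), integral_add (I4 _) (I4 _),
      integral_const_mul, integral_const, smul_eq_mul] at h3
    simp only at h1 h2
    simp only [hq]
    have h4 : ∫ η : UnitVector d, ‖inner ℂ b η.1‖ ^ 2 * ‖inner ℂ a η.1‖ ^ 2 ∂ν =
      ∫ η : UnitVector d, ‖inner ℂ a η.1‖ ^ 2 * ‖inner ℂ b η.1‖ ^ 2 ∂ν := by
      simp_rw [mul_comm]
    linarith
  -- A function with increments O((s − t)²) has zero derivative, so q is constant on great circles.
  -- Only real orthogonality is asked, so b may be a phase multiple of a; this covers d = 1.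
  have circle : ∀ a b : EuclideanSpace ℂ (Fin d), ‖a‖ = 1 → ‖b‖ = 1 →
      (inner ℂ a b).re = 0 → ∀ t : ℝ,
      q (((Real.cos t : ℝ) : ℂ) • a + ((Real.sin t : ℝ) : ℂ) • b) = q a := by
    intro a b ha hb hab t
    set x : ℝ → EuclideanSpace ℂ (Fin d) :=
      fun t => ((Real.cos t : ℝ) : ℂ) • a + ((Real.sin t : ℝ) : ℂ) • b with hx
    have hnorm : ∀ t, ‖x t‖ = 1 := by
      intro t
      have : ‖x t‖ ^ 2 = 1 := by
        rw [hx, @norm_add_sq ℂ, inner_smul_left, inner_smul_right, norm_smul, norm_smul, ha, hb]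
        simp only [Complex.conj_ofReal, RCLike.re_eq_complex_re, Complex.re_ofReal_mul, hab,
          Complex.norm_real, Real.norm_eq_abs, mul_one, sq_abs, mul_zero, add_zero,
          Real.cos_sq_add_sin_sq]
      nlinarith [norm_nonneg (x t)]
    have hlip : ∀ s t, ‖x s - x t‖ ≤ 2 * |s - t| := by
      intro s t
      have : x s - x t = ((Real.cos s - Real.cos t : ℝ) : ℂ) • a +
          ((Real.sin s - Real.sin t : ℝ) : ℂ) • b := by
        simp only [hx, Complex.ofReal_sub, sub_smul]; abel
      rw [this]
      refine (norm_add_le _ _).trans ?_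
      rw [norm_smul, norm_smul, ha, hb, Complex.norm_real, Complex.norm_real, Real.norm_eq_abs,
        Real.norm_eq_abs]
      have c1 := Real.abs_cos_sub_cos_le s t
      have c2 := Real.abs_sin_sub_sin_le s t
      linarith
    have hder : ∀ t, HasDerivAt (fun t => q (x t)) 0 t := by
      intro t
      rw [hasDerivAt_iff_isLittleO]
      have hO : (fun s => q (x s) - q (x t) - (s - t) • (0 : ℝ)) =O[nhds t]
          fun s => (s - t) ^ 2 := by
        refine Asymptotics.IsBigO.of_bound (ν.real Set.univ * 16) (Filter.Eventually.of_forall ?_)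
        intro s
        have l1 := bound (x s) (x t) (hnorm s) (hnorm t)
        have l2 := bound (x t) (x s) (hnorm t) (hnorm s)
        have l3 : ‖x s - x t‖ ^ 2 ≤ 4 * (s - t) ^ 2 := by
          calc _ ≤ (2 * |s - t|) ^ 2 := by gcongr; exact hlip s t
            _ = _ := by rw [mul_pow, sq_abs]; norm_num
        rw [norm_sub_rev] at l2
        have l4 : ν.real Set.univ * (4 * ‖x s - x t‖ ^ 2) ≤
            ν.real Set.univ * 16 * (s - t) ^ 2 := by
          have : 0 ≤ ν.real Set.univ := measureReal_nonneg
          nlinarith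
        rw [smul_zero, sub_zero, Real.norm_eq_abs, Real.norm_eq_abs, abs_of_nonneg (sq_nonneg (s - t))]
        exact abs_le.2 ⟨by linarith, by linarith⟩
      refine hO.trans_isLittleO ?_
      simpa using Asymptotics.isLittleO_pow_sub_sub t (m := 2) (by norm_num)
    have := is_const_of_deriv_eq_zero (fun t => (hder t).differentiableAt)
      (fun t => (hder t).deriv) t 0
    simpa [hx] using this
  -- A great circle joins g to h: h = cos t · g + sin t · k/‖k‖ with t = arccos r. If k = 0 then h =
  -- ±g and the moments agree trivially.
  set r : ℝ := (inner ℂ g.1 h.1).re with hr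
  have hg : ‖g.1‖ = 1 := norm_eq_of_mem_sphere g
  have hh : ‖h.1‖ = 1 := norm_eq_of_mem_sphere h
  have hr1 : |r| ≤ 1 := by
    refine (Complex.abs_re_le_norm _).trans ?_
    simpa [hg, hh] using norm_inner_le_norm (𝕜 := ℂ) g.1 h.1
  set k := h.1 - (r : ℂ) • g.1 with hk
  have hgk : (inner ℂ g.1 k).re = 0 := by
    rw [hk, inner_sub_right, inner_smul_right, inner_self_eq_norm_sq_to_K, hg]
    simp [hr]
  have hknorm : ‖k‖ = Real.sqrt (1 - r ^ 2) := by
    have : ‖k‖ ^ 2 = 1 - r ^ 2 := by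
      have hsymm : (inner ℂ h.1 g.1).re = r := by rw [← inner_conj_symm, Complex.conj_re]
      rw [hk, @norm_sub_sq ℂ, inner_smul_right, norm_smul, hg, hh]
      simp [hsymm]
      ring
    rw [← this, Real.sqrt_sq (norm_nonneg _)]
  have hcos : Real.cos (Real.arccos r) = r := Real.cos_arccos (abs_le.1 hr1).1 (abs_le.1 hr1).2
  by_cases hk0 : k = 0
  · have hhg : h.1 = (r : ℂ) • g.1 := sub_eq_zero.1 hk0
    have hr' : ‖(r : ℂ)‖ = 1 := by
      have := congrArg norm hhg
      rw [norm_smul, hg, hh, mul_one] at this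
      exact this.symm
    rw [hhg]
    simp only [inner_smul_left, Complex.conj_ofReal, norm_mul, hr', one_mul]
  · have hkn : ‖k‖ ≠ 0 := norm_ne_zero_iff.2 hk0
    have := circle g.1 (((‖k‖⁻¹ : ℝ) : ℂ) • k) hg (by rw [norm_smul]; simp [hkn])
      (by rw [inner_smul_right, Complex.re_ofReal_mul, hgk, mul_zero]) (Real.arccos r)
    rw [hcos, Real.sin_arccos, ← hknorm, smul_smul, ← Complex.ofReal_mul,
      mul_inv_cancel₀ hkn, Complex.ofReal_one, one_smul, hk, add_sub_cancel] at this
    exact this.symm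

/-- Under the same condition the second moments are those of a multiple of the uniform measure. -/
theorem second_moment_of_diag_max (ν : Measure (UnitVector d)) [IsFiniteMeasure ν]
    (hB : ∀ g h : UnitVector d, ∫ η, ‖inner ℂ g.1 η.1‖ ^ 2 * ‖inner ℂ h.1 η.1‖ ^ 2 ∂ν ≤
      ∫ η, ‖inner ℂ g.1 η.1‖ ^ 4 ∂ν) (g : UnitVector d) :
    d * ∫ η, ‖inner ℂ g.1 η.1‖ ^ 2 ∂ν = ν.real Set.univ := by
  have hc := integral_inner_pow_four_of_unit ν _
    fun a => fourth_moment_const_of_diag_max ν hB a g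
  rw [integral_inner_sq ν _ hc, measureReal_univ_sphere ν _ hc]
  simp

end Moments

/-! ### The uniform measure -/

section Uniform

variable {d : ℕ}

theorem sum_enorm_sq (u : EuclideanSpace ℂ (Fin d)) :
    ∑ q, ‖u q‖ₑ ^ 2 = ENNReal.ofReal (‖u‖ ^ 2) := by
  rw [EuclideanSpace.norm_sq_eq, ENNReal.ofReal_sum_of_nonneg (fun _ _ => by positivity)]
  simp only [ENNReal.ofReal_pow (norm_nonneg _), ofReal_norm]

instance [NeZero d] : IsProbabilityMeasure (uniform d) := by
  constructor
  rw [uniform, Measure.smul_apply, smul_eq_mul]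
  refine ENNReal.inv_mul_cancel ?_ (measure_ne_top _ _)
  have : Nontrivial (EuclideanSpace ℂ (Fin d)) := by
    have : Nonempty (Fin d) := ⟨0⟩
    infer_instance
  exact Measure.measure_univ_ne_zero.2 (Measure.toSphere_ne_zero _)

instance [NeZero d] : Nonempty (UnitVector d) := by
  by_contra h
  have := not_nonempty_iff.1 h
  have h1 : uniform d Set.univ = 1 := measure_univ
  rw [Set.univ_eq_empty_iff.2 this, measure_empty] at h1
  exact zero_ne_one h1

/-- The action of an isometry on unit vectors. -/
noncomputable def sphereMap (U : EuclideanSpace ℂ (Fin d) ≃ₗᵢ[ℂ] EuclideanSpace ℂ (Fin d)) (η : UnitVector d) :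
    UnitVector d :=
  ⟨U η.1, by rw [mem_sphere_zero_iff_norm, U.norm_map]; exact norm_eq_of_mem_sphere η⟩

theorem continuous_sphereMap
    (U : EuclideanSpace ℂ (Fin d) ≃ₗᵢ[ℂ] EuclideanSpace ℂ (Fin d)) : Continuous (sphereMap U) :=
  (U.continuous.comp continuous_subtype_val).subtype_mk _

/-- A linear equivalence scales Haar measure by a constant; an isometry preserves the unit ball, of
finite positive measure, so the constant is 1. -/
theorem addHaar_preimage_isometry
    (U : EuclideanSpace ℂ (Fin d) ≃ₗᵢ[ℂ] EuclideanSpace ℂ (Fin d))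
    (s : Set (EuclideanSpace ℂ (Fin d))) :
    (Measure.addHaar : Measure (EuclideanSpace ℂ (Fin d))) (U ⁻¹' s) = Measure.addHaar s := by
  let V : EuclideanSpace ℂ (Fin d) ≃L[ℝ] EuclideanSpace ℂ (Fin d) :=
    U.toContinuousLinearEquiv.restrictScalars ℝ
  have h := fun s => Measure.addHaar_preimage_continuousLinearEquiv
    (Measure.addHaar : Measure (EuclideanSpace ℂ (Fin d))) V s
  have hball : V ⁻¹' Metric.ball 0 1 = Metric.ball 0 1 := by
    ext x
    have : V x = U x := rfl
    simp [this]
  have h1 := h (Metric.ball 0 1)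
  rw [hball] at h1
  have h2 := (ENNReal.mul_eq_right (Metric.measure_ball_pos _ _ one_pos).ne'
    measure_ball_lt_top.ne).1 h1.symm
  have h3 := h s
  rw [h2, one_mul] at h3
  exact h3

-- The surface measure of s is, up to a constant, the Haar measure of the cone over s, and U maps
-- cones to cones.
open scoped Pointwise in
theorem measurePreserving_sphereMap
    (U : EuclideanSpace ℂ (Fin d) ≃ₗᵢ[ℂ] EuclideanSpace ℂ (Fin d)) :
    MeasurePreserving (sphereMap U) (uniform d) (uniform d) := by
  refine ⟨(continuous_sphereMap U).measurable, ?_⟩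
  ext s hs
  rw [Measure.map_apply (continuous_sphereMap U).measurable hs, uniform, Measure.smul_apply,
    Measure.smul_apply, Measure.toSphere_apply' _ hs,
    Measure.toSphere_apply' _ ((continuous_sphereMap U).measurable hs),
    ← addHaar_preimage_isometry U (Set.Ioo (0 : ℝ) 1 • (Subtype.val '' s))]
  congr 3
  ext x
  simp only [Set.mem_smul, Set.mem_image, Set.mem_preimage, Subtype.exists]
  have hsmul : ∀ (r : ℝ) v, U (r • v) = r • U v := fun r v =>
    LinearMap.CompatibleSMul.map_smul U.toLinearEquiv.toLinearMap r v
  constructor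
  · rintro ⟨r, hr, _, ⟨v, hv, hvs, rfl⟩, rfl⟩
    exact ⟨r, hr, U v, ⟨U v, by simpa using hv, hvs, rfl⟩, (hsmul r v).symm⟩
  · rintro ⟨r, hr, _, ⟨v, hv, hvs, rfl⟩, hx⟩
    refine ⟨r, hr, U.symm v, ⟨U.symm v, by simpa using hv, ?_, rfl⟩, U.injective ?_⟩
    · convert hvs using 1
      exact Subtype.ext (U.apply_symm_apply v)
    · rw [hsmul, U.apply_symm_apply, hx]

theorem exists_orthonormalBasis_apply_zero [NeZero d] (g : UnitVector d) :
    ∃ b : OrthonormalBasis (Fin d) ℂ (EuclideanSpace ℂ (Fin d)), b 0 = g.1 := by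
  obtain ⟨b, hb⟩ := Orthonormal.exists_orthonormalBasis_extension_of_card_eq (𝕜 := ℂ)
    (E := EuclideanSpace ℂ (Fin d)) (ι := Fin d) (by simp) (v := fun _ => g.1) (s := {0}) (by
      constructor
      · intro i; simp
      · intro i j hij
        exact absurd (Subsingleton.elim i j) hij)
  exact ⟨b, hb 0 rfl⟩

theorem exists_isometry_map [NeZero d] (g h : UnitVector d) :
    ∃ U : EuclideanSpace ℂ (Fin d) ≃ₗᵢ[ℂ] EuclideanSpace ℂ (Fin d), U g.1 = h.1 := by
  obtain ⟨b, hb⟩ := exists_orthonormalBasis_apply_zero g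
  obtain ⟨b', hb'⟩ := exists_orthonormalBasis_apply_zero h
  exact ⟨b.equiv b' (Equiv.refl _), by rw [← hb, ← hb']; simp⟩

/-- Isometries act transitively on unit vectors, so invariance makes the moment constant on them;
total mass 1 then fixes its value. -/
theorem uniform_fourth_moment [NeZero d] (a : EuclideanSpace ℂ (Fin d)) :
    ∫ η, ‖inner ℂ a η.1‖ ^ 4 ∂uniform d = 2 / (d * (d + 1)) * ‖a‖ ^ 4 := by
  obtain ⟨g₀⟩ : Nonempty (UnitVector d) := inferInstance
  have hc := integral_inner_pow_four_of_unit (uniform d)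
    (∫ η, ‖inner ℂ g₀.1 η.1‖ ^ 4 ∂uniform d) (fun g => by
      obtain ⟨U, hU⟩ := exists_isometry_map g₀ g
      conv_lhs => rw [← (measurePreserving_sphereMap U).map_eq]
      rw [integral_map (f := fun η : UnitVector d => ‖inner ℂ g.1 η.1‖ ^ 4)
        (continuous_sphereMap U).aemeasurable
        ((continuous_norm_inner_sphere g.1).pow 4).aestronglyMeasurable]
      simp only [sphereMap, ← hU, U.inner_map_map])
  have h1 := measureReal_univ_sphere _ _ hc
  have hd : (d : ℝ) ≠ 0 := Nat.cast_ne_zero.2 (NeZero.ne d)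
  rw [hc]
  congr 1
  rw [eq_div_iff (by positivity)]
  rw [probReal_univ] at h1
  linarith

theorem fidelity_eq_ofReal (v w : UnitVector d) :
    fidelity v w = ENNReal.ofReal (‖inner ℂ v.1 w.1‖ ^ 2) := by
  rw [fidelity, ← ofReal_norm, ENNReal.ofReal_pow (norm_nonneg _)]

theorem fidelity_comm (v w : UnitVector d) : fidelity v w = fidelity w v := by
  rw [fidelity_eq_ofReal, fidelity_eq_ofReal, norm_inner_symm]

theorem continuous_fidelity : Continuous fun p : UnitVector d × UnitVector d =>
    fidelity p.1 p.2 := by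
  unfold fidelity
  fun_prop

theorem measurable_fidelity : Measurable fun p : UnitVector d × UnitVector d =>
    fidelity p.1 p.2 := continuous_fidelity.measurable

/-- The polarized fourth moment with c = 2/(d(d+1)), moved to `ℝ≥0∞`. -/
theorem lintegral_inner_mul_fidelity [NeZero d] (n : EuclideanSpace ℂ (Fin d)) (g : UnitVector d) :
    ∫⁻ η : UnitVector d, ‖inner ℂ n η.1‖ₑ ^ 2 * fidelity g η ∂uniform d =
      ENNReal.ofReal (1 / (d * (d + 1)) * (‖n‖ ^ 2 + ‖inner ℂ n g.1‖ ^ 2)) := by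
  have h := integral_inner_sq_mul_inner_sq (uniform d) _ uniform_fourth_moment n g.1
  have e : ∀ η : UnitVector d, ‖inner ℂ n η.1‖ₑ ^ 2 * fidelity g η =
      ENNReal.ofReal (‖inner ℂ n η.1‖ ^ 2 * ‖inner ℂ g.1 η.1‖ ^ 2) := fun η => by
    rw [fidelity_eq_ofReal, ENNReal.ofReal_mul (by positivity), ENNReal.ofReal_pow (norm_nonneg _),
      ENNReal.ofReal_pow (norm_nonneg _), ofReal_norm, ofReal_norm]
  rw [lintegral_congr e, ← ofReal_integral_eq_lintegral_ofReal
    (integrable_of_continuous_sphere (by fun_prop) _) (ae_of_all _ fun η => by positivity), h,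
    norm_eq_of_mem_sphere]
  congr 1
  ring

theorem lintegral_inner_sq [NeZero d] (n : EuclideanSpace ℂ (Fin d)) :
    ∫⁻ η : UnitVector d, ‖inner ℂ n η.1‖ₑ ^ 2 ∂uniform d = ENNReal.ofReal (1 / d * ‖n‖ ^ 2) := by
  have e : ∀ η : UnitVector d, ‖inner ℂ n η.1‖ₑ ^ 2 = ENNReal.ofReal (‖inner ℂ n η.1‖ ^ 2) :=
    fun η => by rw [ENNReal.ofReal_pow (norm_nonneg _), ofReal_norm]
  have hd : (d : ℝ) ≠ 0 := Nat.cast_ne_zero.2 (NeZero.ne d)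
  rw [lintegral_congr e, ← ofReal_integral_eq_lintegral_ofReal
    (integrable_of_continuous_sphere (by fun_prop) _) (ae_of_all _ fun η => by positivity),
    integral_inner_sq _ _ uniform_fourth_moment]
  congr 1
  field_simp

/-- The average of a quadratic form against a fidelity. -/
theorem lintegral_inner_mul_fidelity_eq [NeZero d] (n : EuclideanSpace ℂ (Fin d))
    (η : UnitVector d) :
    d * (d + 1) * ∫⁻ ψ : UnitVector d, ‖inner ℂ n ψ.1‖ₑ ^ 2 * fidelity ψ η ∂uniform d =
      d * ∫⁻ ψ : UnitVector d, ‖inner ℂ n ψ.1‖ₑ ^ 2 ∂uniform d + ‖inner ℂ n η.1‖ₑ ^ 2 := by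
  have hd : (d : ℝ) ≠ 0 := Nat.cast_ne_zero.2 (NeZero.ne d)
  simp_rw [fidelity_comm _ η]
  rw [lintegral_inner_mul_fidelity, lintegral_inner_sq, ← ofReal_norm,
    ← ENNReal.ofReal_pow (norm_nonneg _), ← ENNReal.ofReal_natCast, ← ENNReal.ofReal_one,
    ← ENNReal.ofReal_add (by positivity) (by positivity), ← ENNReal.ofReal_mul (by positivity),
    ← ENNReal.ofReal_mul (by positivity), ← ENNReal.ofReal_mul (by positivity),
    ← ENNReal.ofReal_add (by positivity) (by positivity)]
  congr 1
  field_simp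

end Uniform

/-! ### Estimation from a single copy -/

open scoped MatrixOrder Matrix.Norms.L2Operator in
/-- The optimal single-copy estimation fidelity is at most `2 / (d + 1)`. -/
theorem epsilonM_le (d : ℕ) [NeZero d] : epsilonM d ≤ ENNReal.ofReal (2 / (d + 1)) := by
  refine iSup_le fun E => ?_
  have hd : (d : ℝ) ≠ 0 := Nat.cast_ne_zero.2 (NeZero.ne d)
  have hform : ∀ (v : Fin d → ℂ), Measurable fun ω =>
      ENNReal.ofReal (dotProduct (star v) ((E.povm ω).mulVec v)).re := by
    intro v
    have := E.measurable_povm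
    refine ENNReal.measurable_ofReal.comp (Complex.measurable_re.comp ?_)
    simp only [dotProduct, Matrix.mulVec]
    fun_prop
  have hmeas : Measurable fun p : UnitVector d × E.Out =>
      ENNReal.ofReal (dotProduct (star ⇑p.1.1) ((E.povm p.2).mulVec ⇑p.1.1)).re *
        fidelity (E.guess p.2) p.1 := by
    refine Measurable.mul ?_ (measurable_fidelity.comp
      ((E.measurable_guess.comp measurable_snd).prodMk measurable_fst))
    have h1 : ∀ i j, Measurable fun p : UnitVector d × E.Out => E.povm p.2 i j :=
      fun i j => (E.measurable_povm i j).comp measurable_snd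
    have h2 : ∀ i, Measurable fun p : UnitVector d × E.Out => p.1.1 i := fun i =>
      (show Continuous fun η : UnitVector d => η.1 i by fun_prop).measurable.comp measurable_fst
    refine ENNReal.measurable_ofReal.comp (Complex.measurable_re.comp ?_)
    simp only [dotProduct, Matrix.mulVec, Pi.star_apply]
    have h3 : ∀ i, Measurable fun p : UnitVector d × E.Out => star (p.1.1 i) := fun i =>
      continuous_star.measurable.comp (h2 i)
    fun_prop
  rw [Estimator.score, lintegral_lintegral_swap hmeas.aemeasurable]
  have hω : ∀ ω, ∫⁻ η : UnitVector d,
      ENNReal.ofReal (dotProduct (star ⇑η.1) ((E.povm ω).mulVec ⇑η.1)).re *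
        fidelity (E.guess ω) η ∂uniform d ≤ ENNReal.ofReal (2 / (d * (d + 1))) *
      ∑ i, ENNReal.ofReal (dotProduct (star (Pi.single i 1)) ((E.povm ω).mulVec (Pi.single i 1))).re := by
    intro ω
    -- Writing the effect as N*N turns its quadratic form into ∑ₖ |⟨nₖ, v⟩|², where nₖ is the
    -- conjugate of the k-th row of N; each term is covered by the moment formula.
    obtain ⟨N, hN⟩ := CStarAlgebra.nonneg_iff_eq_star_mul_self.mp (E.posSemidef ω).nonneg
    rw [Matrix.star_eq_conjTranspose] at hN
    have hv : ∀ v : Fin d → ℂ, ENNReal.ofReal (dotProduct (star v) ((E.povm ω).mulVec v)).re =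
        ∑ k, ‖N.mulVec v k‖ₑ ^ 2 := by
      intro v
      rw [hN, ← Matrix.mulVec_mulVec, Matrix.dotProduct_mulVec, Matrix.vecMul_conjTranspose,
        star_star, dotProduct, Complex.re_sum, ENNReal.ofReal_sum_of_nonneg]
      · refine Finset.sum_congr rfl fun k _ => ?_
        rw [← ofReal_norm, ← ENNReal.ofReal_pow (norm_nonneg _), Complex.sq_norm,
          Complex.normSq_apply]
        simp
      · intro k _
        simp
        nlinarith [sq_nonneg (N.mulVec v k).re, sq_nonneg (N.mulVec v k).im]
    simp_rw [hv]
    let n : Fin d → EuclideanSpace ℂ (Fin d) := fun k => WithLp.toLp 2 fun j => star (N k j)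
    have hn : ∀ k (v : EuclideanSpace ℂ (Fin d)), N.mulVec v k = inner ℂ (n k) v := by
      intro k v
      simp [n, PiLp.inner_apply, Matrix.mulVec, dotProduct, mul_comm]
    simp_rw [hn, Finset.sum_mul]
    have hm : ∀ k, Measurable fun η : UnitVector d =>
        ‖inner ℂ (n k) η.1‖ₑ ^ 2 * fidelity (E.guess ω) η := fun k =>
      (Continuous.measurable (by fun_prop)).mul
        (measurable_fidelity.comp (measurable_const.prodMk measurable_id))
    rw [lintegral_finsetSum _ fun k _ => hm k]
    simp_rw [lintegral_inner_mul_fidelity]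
    rw [Finset.sum_comm, Finset.mul_sum]
    refine Finset.sum_le_sum fun k _ => ?_
    have h1 : ∑ i, ‖inner ℂ (n k) (WithLp.toLp 2 (Pi.single i 1))‖ₑ ^ 2 =
        ENNReal.ofReal (‖n k‖ ^ 2) := by
      rw [EuclideanSpace.norm_sq_eq, ENNReal.ofReal_sum_of_nonneg (fun _ _ => by positivity)]
      refine Finset.sum_congr rfl fun i _ => ?_
      rw [ENNReal.ofReal_pow (norm_nonneg _), ofReal_norm, ← hn]
      simp [n]
    rw [h1, ← ENNReal.ofReal_mul (by positivity)]
    refine ENNReal.ofReal_le_ofReal ?_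
    -- Cauchy–Schwarz is the only inequality: the guess can at best be parallel to nₖ, and this
    -- yields the factor 2.
    have h2 := norm_inner_le_norm (𝕜 := ℂ) (n k) (E.guess ω).1
    rw [norm_eq_of_mem_sphere, mul_one] at h2
    have h3 : ‖inner ℂ (n k) (E.guess ω).1‖ ^ 2 ≤ ‖n k‖ ^ 2 := by gcongr
    calc _ ≤ 1 / ((d : ℝ) * (d + 1)) * (‖n k‖ ^ 2 + ‖n k‖ ^ 2) := by gcongr
      _ = _ := by ring
  -- The remaining integrand is the trace of the effect; normalization on each standard basis vector
  -- makes its integral d.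
  refine (lintegral_mono hω).trans ?_
  rw [lintegral_const_mul _ (Finset.measurable_fun_sum _ fun i _ => hform _),
    lintegral_finsetSum _ fun i _ => hform _]
  simp_rw [E.total]
  have h1 : ∀ i : Fin d, ∑ j, ‖(Pi.single i 1 : Fin d → ℂ) j‖ₑ ^ 2 = 1 := by
    intro i
    rw [Finset.sum_eq_single i] <;> simp +contextual
  simp_rw [h1]
  rw [Finset.sum_const, Finset.card_univ, Fintype.card_fin, nsmul_eq_mul, mul_one,
    ← ENNReal.ofReal_natCast, ← ENNReal.ofReal_mul (by positivity)]
  refine ENNReal.ofReal_le_ofReal (le_of_eq ?_)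
  field_simp

/-! ### Local operations -/

namespace LocalOp

variable {C : Type} [MeasurableSpace C] {P M : Registers}

/-- Basis labels of a family of registers, split into the registers in `S` and the others. -/
abbrev splitBasis (R : Registers) (S : Finset R.Idx) :
    R.Basis ≃ (∀ i : S, Fin (R.dim i)) × (∀ i : {i // i ∉ S}, Fin (R.dim i)) :=
  Equiv.piEquivPiSubtypeProd (· ∈ S) fun i => Fin (R.dim i)

theorem splitBasis_symm_of_mem {R : Registers} {S : Finset R.Idx}
    (l : ∀ i : S, Fin (R.dim i)) (r : ∀ i : {i // i ∉ S}, Fin (R.dim i)) :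
    (fun i : S => (splitBasis R S).symm (l, r) i) = l :=
  congrArg Prod.fst ((splitBasis R S).apply_symm_apply (l, r))

theorem splitBasis_symm_eq_iff {R : Registers} {S : Finset R.Idx}
    (l l' : ∀ i : S, Fin (R.dim i)) (r r' : ∀ i : {i // i ∉ S}, Fin (R.dim i)) :
    (∀ i, i ∉ S → (splitBasis R S).symm (l, r) i = (splitBasis R S).symm (l', r') i) ↔ r = r' := by
  have h : ∀ l r, (fun i : {i // i ∉ S} => (splitBasis R S).symm (l, r) i) = r := fun l r =>
    congrArg Prod.snd ((splitBasis R S).apply_symm_apply (l, r))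
  constructor
  · intro hi
    rw [← h l r, ← h l' r']
    funext i
    exact hi i i.2
  · rintro rfl i hi
    exact (congrFun (h l r) ⟨i, hi⟩).trans (congrFun (h l' r) ⟨i, hi⟩).symm

theorem sum_basis {α : Type*} [AddCommMonoid α] {R : Registers} (S : Finset R.Idx)
    (G : R.Basis → α) : ∑ a, G a = ∑ r, ∑ l, G ((splitBasis R S).symm (l, r)) := by
  rw [← (splitBasis R S).symm.sum_comp, Fintype.sum_prod_type_right]

/-- In the split labels K ⊗ 1 is block diagonal: the untouched labels r and s only contribute
Kronecker deltas. -/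
theorem lift_split (op : LocalOp C P M)
    (K : Matrix (LocalBasis P M op.priv op.msgs) (LocalBasis P M op.priv op.msgs) ℂ)
    (l l' : ∀ i : op.priv, Fin (P.dim i)) (r r' : ∀ i : {i // i ∉ op.priv}, Fin (P.dim i))
    (k k' : ∀ i : op.msgs, Fin (M.dim i)) (s s' : ∀ i : {i // i ∉ op.msgs}, Fin (M.dim i)) :
    op.lift K ((splitBasis P op.priv).symm (l, r)) ((splitBasis M op.msgs).symm (k, s))
      ((splitBasis P op.priv).symm (l', r')) ((splitBasis M op.msgs).symm (k', s')) =
    if r = r' then if s = s' then K (l, k) (l', k') else 0 else 0 := by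
  unfold lift
  by_cases hr : r = r'
  · by_cases hs : s = s'
    · rw [if_pos ⟨(splitBasis_symm_eq_iff l l' r r').2 hr, (splitBasis_symm_eq_iff k k' s s').2 hs⟩,
        if_pos hr, if_pos hs]
      exact congrArg₂ K (Prod.ext (splitBasis_symm_of_mem l r) (splitBasis_symm_of_mem k s))
        (Prod.ext (splitBasis_symm_of_mem l' r') (splitBasis_symm_of_mem k' s'))
    · rw [if_neg fun h => hs ((splitBasis_symm_eq_iff k k' s s').1 h.2), if_pos hr, if_neg hs]
  · rw [if_neg fun h => hr ((splitBasis_symm_eq_iff l l' r r').1 h.1), if_neg hr]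

theorem evolve_split {Z : Type} (op : LocalOp C P M) (c : C) (ω : op.Out) (x : P.Idx → ℝ)
    (y : M.Idx → ℝ) (ψ : P.Basis → M.Basis → Z → ℂ)
    (l : ∀ i : op.priv, Fin (P.dim i)) (r : ∀ i : {i // i ∉ op.priv}, Fin (P.dim i))
    (k : ∀ i : op.msgs, Fin (M.dim i)) (s : ∀ i : {i // i ∉ op.msgs}, Fin (M.dim i)) (z : Z) :
    op.evolve c ω x y ψ ((splitBasis P op.priv).symm (l, r)) ((splitBasis M op.msgs).symm (k, s)) z =
      (op.kraus c (op.read x y) ω).mulVec (fun p => ψ ((splitBasis P op.priv).symm (p.1, r))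
        ((splitBasis M op.msgs).symm (p.2, s)) z) (l, k) := by
  simp only [evolve, Matrix.mulVec, dotProduct]
  rw [sum_basis op.priv, Fintype.sum_prod_type]
  simp_rw [sum_basis op.msgs, lift_split, ite_mul, zero_mul]
  rw [Finset.sum_eq_single r]
  · refine Finset.sum_congr rfl fun l' _ => ?_
    rw [Finset.sum_eq_single s]
    · simp
    · intro s' _ hs
      simp [hs.symm]
    · simp
  · intro r' _ hr
    simp [hr.symm]
  · simp

theorem sum_basis_basis {α : Type*} [AddCommMonoid α] {Z : Type} [Fintype Z] (op : LocalOp C P M)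
    (G : P.Basis → M.Basis → Z → α) :
    ∑ a, ∑ m, ∑ z, G a m z = ∑ r, ∑ s, ∑ z, ∑ p : LocalBasis P M op.priv op.msgs,
      G ((splitBasis P op.priv).symm (p.1, r)) ((splitBasis M op.msgs).symm (p.2, s)) z := by
  rw [sum_basis op.priv]
  refine Finset.sum_congr rfl fun r _ => ?_
  simp_rw [sum_basis op.msgs]
  rw [Finset.sum_comm]
  refine Finset.sum_congr rfl fun s _ => ?_
  simp_rw [Fintype.sum_prod_type]
  rw [Finset.sum_comm' (t' := Finset.univ) (s' := fun _ => Finset.univ) (by simp)]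
  simp_rw [Finset.sum_comm (s := (Finset.univ : Finset Z))]
  rw [Finset.sum_comm]

theorem measurable_kraus_right (op : LocalOp C P M) (c : C)
    (x : LocalData P M op.priv op.msgs) (i j) : Measurable fun ω => op.kraus c x ω i j :=
  (op.measurable_kraus i j).comp
    (measurable_const.prodMk (measurable_const.prodMk measurable_id))

/-- For each fixed value of the spectator labels, evolution is multiplication by the Kraus matrix,
so `complete` applies slice by slice. -/
theorem lintegral_norm_evolve {Z : Type} [Fintype Z] (op : LocalOp C P M) (c : C)
    (x : P.Idx → ℝ) (y : M.Idx → ℝ) (ψ : P.Basis → M.Basis → Z → ℂ) :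
    ∫⁻ ω, ∑ a, ∑ m, ∑ z, ‖op.evolve c ω x y ψ a m z‖ₑ ^ 2 ∂op.μ =
      ∑ a, ∑ m, ∑ z, ‖ψ a m z‖ₑ ^ 2 := by
  simp_rw [op.sum_basis_basis, evolve_split]
  have hm : ∀ v : LocalBasis P M op.priv op.msgs → ℂ, Measurable fun ω =>
      ∑ p, ‖(op.kraus c (op.read x y) ω).mulVec v p‖ₑ ^ 2 := by
    intro v
    have := op.measurable_kraus_right c (op.read x y)
    simp only [Matrix.mulVec, dotProduct]
    fun_prop
  rw [lintegral_finsetSum _ fun r _ => Finset.measurable_fun_sum _ fun s _ =>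
    Finset.measurable_fun_sum _ fun z _ => hm _]
  refine Finset.sum_congr rfl fun r _ => ?_
  rw [lintegral_finsetSum _ fun s _ => Finset.measurable_fun_sum _ fun z _ => hm _]
  refine Finset.sum_congr rfl fun s _ => ?_
  rw [lintegral_finsetSum _ fun z _ => hm _]
  exact Finset.sum_congr rfl fun z _ => op.complete _ _ _

theorem isLinearMap_evolve {Z : Type} (op : LocalOp C P M) (c : C) (ω : op.Out)
    (x : P.Idx → ℝ) (y : M.Idx → ℝ) :
    IsLinearMap ℂ (op.evolve c ω x y : (P.Basis → M.Basis → Z → ℂ) → _) where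
  map_add ψ φ := by
    funext a m z
    simp [evolve, mul_add, Finset.sum_add_distrib]
  map_smul t ψ := by
    funext a m z
    simp [evolve, Finset.mul_sum, mul_left_comm]

theorem measurable_evolve {Z : Type} {X : Type*} [MeasurableSpace X] (op : LocalOp C P M)
    {c : X → C} {ω : X → op.Out} {x : X → P.Idx → ℝ} {y : X → M.Idx → ℝ}
    {ψ : X → P.Basis → M.Basis → Z → ℂ} (hc : Measurable c) (hω : Measurable ω)
    (hx : Measurable x) (hy : Measurable y) (hψ : ∀ a m z, Measurable fun t => ψ t a m z) (a m z) :
    Measurable fun t => op.evolve (c t) (ω t) (x t) (y t) (ψ t) a m z := by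
  have hr : Measurable fun t => op.read (x t) (y t) := by
    unfold read
    refine Measurable.prodMk (measurable_pi_lambda _ fun i => (measurable_pi_apply _).comp hx)
      (measurable_pi_lambda _ fun i => (measurable_pi_apply _).comp hy)
  refine Finset.measurable_fun_sum _ fun a' _ => Finset.measurable_fun_sum _ fun m' _ =>
    Measurable.mul ?_ (hψ a' m' z)
  unfold lift
  split_ifs
  · exact (op.measurable_kraus _ _).comp (hc.prodMk (hr.prodMk hω))
  · exact measurable_const

theorem measurable_update_comp {X : Type*} [MeasurableSpace X] (op : LocalOp C P M)
    {c : X → C} {ω : X → op.Out} {x : X → P.Idx → ℝ} {y : X → M.Idx → ℝ}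
    (hc : Measurable c) (hω : Measurable ω) (hx : Measurable x) (hy : Measurable y) :
    Measurable fun t => op.update (c t) (op.read (x t) (y t)) (ω t) := by
  have hr : Measurable fun t => op.read (x t) (y t) := by
    unfold read
    refine Measurable.prodMk (measurable_pi_lambda _ fun i => (measurable_pi_apply _).comp hx)
      (measurable_pi_lambda _ fun i => (measurable_pi_apply _).comp hy)
  exact op.measurable_update.comp (hc.prodMk (hr.prodMk hω))

theorem measurable_newPriv {X : Type*} [MeasurableSpace X] (op : LocalOp C P M)
    {c : X → C} {ω : X → op.Out} {x : X → P.Idx → ℝ} {y : X → M.Idx → ℝ}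
    (hc : Measurable c) (hω : Measurable ω) (hx : Measurable x) (hy : Measurable y) :
    Measurable fun t => op.newPriv (c t) (ω t) (x t) (y t) := by
  refine measurable_pi_lambda _ fun i => ?_
  unfold newPriv
  split_ifs with h
  · exact (measurable_pi_apply _).comp (op.measurable_update_comp hc hω hx hy).fst
  · exact (measurable_pi_apply _).comp hx

theorem measurable_newMsgs {X : Type*} [MeasurableSpace X] (op : LocalOp C P M)
    {c : X → C} {ω : X → op.Out} {x : X → P.Idx → ℝ} {y : X → M.Idx → ℝ}
    (hc : Measurable c) (hω : Measurable ω) (hx : Measurable x) (hy : Measurable y) :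
    Measurable fun t => op.newMsgs (c t) (ω t) (x t) (y t) := by
  refine measurable_pi_lambda _ fun i => ?_
  unfold newMsgs
  split_ifs with h
  · exact (measurable_pi_apply _).comp (op.measurable_update_comp hc hω hx hy).snd
  · exact (measurable_pi_apply _).comp hy

end LocalOp

/-! ### Runs -/

section Runs

variable {C : Type} [MeasurableSpace C] {A M B : Registers}

theorem measurable_actAlice {X : Type*} [MeasurableSpace X] (op : LocalOp C A M)
    {c : X → C} {ω : X → op.Out} {s : X → Config A M B} (hc : Measurable c) (hω : Measurable ω)
    (hs : Measurable s) : Measurable fun t => actAlice op (c t) (ω t) (s t) := by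
  refine (op.measurable_newPriv hc hω hs.fst hs.snd.fst).prodMk
    ((op.measurable_newMsgs hc hω hs.fst hs.snd.fst).prodMk (hs.snd.snd.fst.prodMk ?_))
  refine measurable_pi_lambda _ fun a => measurable_pi_lambda _ fun m =>
    measurable_pi_lambda _ fun b => op.measurable_evolve hc hω hs.fst hs.snd.fst (fun a m b => ?_)
      a m b
  exact measurable_pi_apply b |>.comp <| measurable_pi_apply m |>.comp <|
    measurable_pi_apply a |>.comp hs.snd.snd.snd

theorem measurable_actBob {X : Type*} [MeasurableSpace X] (op : LocalOp Unit B M)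
    {ω : X → op.Out} {s : X → Config A M B} (hω : Measurable ω)
    (hs : Measurable s) : Measurable fun t => actBob op (ω t) (s t) := by
  refine hs.fst.prodMk ((op.measurable_newMsgs measurable_const hω hs.snd.snd.fst hs.snd.fst).prodMk
    ((op.measurable_newPriv measurable_const hω hs.snd.snd.fst hs.snd.fst).prodMk ?_))
  refine measurable_pi_lambda _ fun a => measurable_pi_lambda _ fun m =>
    measurable_pi_lambda _ fun b => op.measurable_evolve measurable_const hω hs.snd.snd.fst
      hs.snd.fst (fun b m a => ?_) b m a
  exact measurable_pi_apply b |>.comp <| measurable_pi_apply m |>.comp <|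
    measurable_pi_apply a |>.comp hs.snd.snd.snd

/-- Joint measurability in the parameter and the configuration is the form that survives the
induction, since each step integrates one more variable. -/
theorem measurable_total (L : List (Step C A M B)) {F : Config A M B → ℝ≥0∞} (hF : Measurable F) :
    Measurable fun p : C × Config A M B => total p.1 L F p.2 := by
  induction L with
  | nil => exact hF.comp measurable_snd
  | cons op L ih =>
    rcases op with op | op
    · refine Measurable.lintegral_prod_right' (ν := op.μ)
        (f := fun q : (C × Config A M B) × op.Out =>
          total q.1.1 L F (actAlice op q.1.1 q.2 q.1.2)) ?_
      exact ih.comp (measurable_fst.fst.prodMk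
        (measurable_actAlice op measurable_fst.fst measurable_snd measurable_fst.snd))
    · refine Measurable.lintegral_prod_right' (ν := op.μ)
        (f := fun q : (C × Config A M B) × op.Out =>
          total q.1.1 L F (actBob op q.2 q.1.2)) ?_
      exact ih.comp (measurable_fst.fst.prodMk
        (measurable_actBob op measurable_snd measurable_fst.snd))

theorem measurable_weight : Measurable (Config.weight : Config A M B → ℝ≥0∞) := by
  refine Finset.measurable_fun_sum _ fun a _ => Finset.measurable_fun_sum _ fun m _ =>
    Finset.measurable_fun_sum _ fun b _ => Measurable.pow_const (Measurable.enorm ?_) 2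
  exact measurable_pi_apply b |>.comp <| measurable_pi_apply m |>.comp <|
    measurable_pi_apply a |>.comp measurable_snd.snd.snd

theorem measurable_weight_mul {f : (B.Idx → ℝ) → ℝ≥0∞} (hf : Measurable f) :
    Measurable fun t : Config A M B => t.weight * f t.2.2.1 :=
  measurable_weight.mul (hf.comp measurable_snd.snd.fst)

/-- Total probability is conserved. -/
theorem total_weight (c : C) (L : List (Step C A M B)) (s : Config A M B) :
    total c L Config.weight s = s.weight := by
  induction L generalizing s with
  | nil => rfl
  | cons op L ih =>
    rcases op with op | op
    · simp_rw [total, ih, Config.weight, actAlice]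
      exact op.lintegral_norm_evolve c s.1 s.2.1 s.2.2.2
    -- Alice's labels play the role of the spectator `Z` in Bob's operation, so the sums are
    -- reordered first.
    · have h : ∀ G : A.Basis → M.Basis → B.Basis → ℝ≥0∞,
          ∑ a, ∑ m, ∑ b, G a m b = ∑ b, ∑ m, ∑ a, G a m b := by
        intro G
        rw [Finset.sum_comm]
        simp_rw [Finset.sum_comm (s := (Finset.univ : Finset A.Basis))]
        rw [Finset.sum_comm]
      simp_rw [total, ih, Config.weight, actBob, h]
      exact op.lintegral_norm_evolve () s.2.2.1 s.2.1 fun b m a => s.2.2.2 a m b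

theorem total_add (c : C) (L : List (Step C A M B)) {F G : Config A M B → ℝ≥0∞}
    (hF : Measurable F) (s : Config A M B) :
    total c L (fun t => F t + G t) s = total c L F s + total c L G s := by
  induction L generalizing s with
  | nil => rfl
  | cons op L ih =>
    rcases op with op | op
    · simp_rw [total, ih]
      exact lintegral_add_left ((measurable_total L hF).comp (measurable_const.prodMk
        (measurable_actAlice op measurable_const measurable_id measurable_const))) _
    · simp_rw [total, ih]
      exact lintegral_add_left ((measurable_total L hF).comp (measurable_const.prodMk
        (measurable_actBob op measurable_id measurable_const))) _

theorem total_mul_const (c : C) (L : List (Step C A M B)) {F : Config A M B → ℝ≥0∞}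
    (hF : Measurable F) (r : ℝ≥0∞) (s : Config A M B) :
    total c L (fun t => F t * r) s = total c L F s * r := by
  induction L generalizing s with
  | nil => rfl
  | cons op L ih =>
    rcases op with op | op
    · simp_rw [total, ih]
      exact lintegral_mul_const _ ((measurable_total L hF).comp (measurable_const.prodMk
        (measurable_actAlice op measurable_const measurable_id measurable_const)))
    · simp_rw [total, ih]
      exact lintegral_mul_const _ ((measurable_total L hF).comp (measurable_const.prodMk
        (measurable_actBob op measurable_id measurable_const)))

/-- The identity satisfied by quadratic forms in a uniformly random state, by the value of its
fourth moments. -/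
def HasDesignIdentity {d : ℕ} (f : UnitVector d → ℝ≥0∞) : Prop :=
  Measurable f ∧ ∀ η, d * (d + 1) * ∫⁻ ψ, f ψ * fidelity ψ η ∂uniform d =
    d * ∫⁻ ψ, f ψ ∂uniform d + f η

/-! ### Quadratic forms in the state and their averages against a fidelity -/

section Design

variable {d : ℕ}

theorem measurable_fidelity_left (η : UnitVector d) : Measurable fun ψ => fidelity ψ η :=
  Measurable.comp (g := fun p : UnitVector d × UnitVector d => fidelity p.1 p.2)
    (f := fun ψ => (ψ, η)) measurable_fidelity measurable_prodMk_right

theorem hasDesignIdentity_inner [NeZero d] (n : EuclideanSpace ℂ (Fin d)) :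
    HasDesignIdentity fun ψ : UnitVector d => ‖inner ℂ n ψ.1‖ₑ ^ 2 :=
  ⟨Continuous.measurable (by fun_prop), lintegral_inner_mul_fidelity_eq n⟩

/-- By Riesz representation every linear functional is an inner product with a fixed vector. -/
theorem hasDesignIdentity_linear [NeZero d] {ℓ : EuclideanSpace ℂ (Fin d) → ℂ}
    (hℓ : IsLinearMap ℂ ℓ) : HasDesignIdentity fun ψ : UnitVector d => ‖ℓ ψ.1‖ₑ ^ 2 := by
  have h := hasDesignIdentity_inner ((InnerProductSpace.toDual ℂ (EuclideanSpace ℂ (Fin d))).symm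
    (LinearMap.toContinuousLinearMap (hℓ.mk' ℓ)))
  simp_rw [InnerProductSpace.toDual_symm_apply] at h
  exact h

theorem HasDesignIdentity.mul_const {f : UnitVector d → ℝ≥0∞} (hf : HasDesignIdentity f)
    (r : ℝ≥0∞) : HasDesignIdentity fun ψ => f ψ * r := by
  refine ⟨hf.1.mul_const r, fun η => ?_⟩
  have hm : Measurable fun ψ => f ψ * fidelity ψ η := hf.1.mul (measurable_fidelity_left η)
  simp_rw [mul_right_comm _ r]
  rw [lintegral_mul_const _ hf.1, lintegral_mul_const _ hm,
    ← mul_assoc, hf.2 η, add_mul, mul_assoc]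

theorem HasDesignIdentity.sum {ι : Type*} {s : Finset ι} {f : ι → UnitVector d → ℝ≥0∞}
    (hf : ∀ i, HasDesignIdentity (f i)) : HasDesignIdentity fun ψ => ∑ i ∈ s, f i ψ := by
  refine ⟨Finset.measurable_fun_sum _ fun i _ => (hf i).1, fun η => ?_⟩
  have hm : ∀ i, Measurable fun ψ => f i ψ * fidelity ψ η := fun i =>
    (hf i).1.mul (measurable_fidelity_left η)
  simp_rw [Finset.sum_mul]
  rw [lintegral_finsetSum _ fun i _ => (hf i).1, lintegral_finsetSum _ fun i _ => hm i, Finset.mul_sum,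
    Finset.mul_sum, ← Finset.sum_add_distrib]
  exact Finset.sum_congr rfl fun i _ => (hf i).2 η

/-- The identity is linear in f and uses only sums and products, so Tonelli passes it through the
outcome integral without any finiteness condition. -/
theorem HasDesignIdentity.lintegral [NeZero d] {Ω : Type*} [MeasurableSpace Ω] {μ : Measure Ω}
    [SFinite μ]
    {f : UnitVector d → Ω → ℝ≥0∞} (hm : Measurable (Function.uncurry f))
    (hf : ∀ ω, HasDesignIdentity fun ψ => f ψ ω) : HasDesignIdentity fun ψ => ∫⁻ ω, f ψ ω ∂μ := by
  refine ⟨hm.lintegral_prod_right', fun η => ?_⟩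
  have hm' : Measurable (Function.uncurry fun ψ ω => f ψ ω * fidelity ψ η) :=
    hm.mul ((measurable_fidelity_left η).comp measurable_fst)
  have e : ∀ ψ, (∫⁻ ω, f ψ ω ∂μ) * fidelity ψ η = ∫⁻ ω, f ψ ω * fidelity ψ η ∂μ := fun ψ =>
    (lintegral_mul_const _ (hm.comp measurable_prodMk_left)).symm
  simp_rw [e]
  have h1 : Measurable fun ω => ∫⁻ ψ, f ψ ω * fidelity ψ η ∂uniform d := hm'.lintegral_prod_left'
  have h2 : Measurable fun ω => ∫⁻ ψ, f ψ ω ∂uniform d := hm.lintegral_prod_left'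
  rw [lintegral_lintegral_swap hm'.aemeasurable, lintegral_lintegral_swap hm.aemeasurable,
    ← lintegral_const_mul _ h1, ← lintegral_const_mul _ h2, ← lintegral_add_left (h2.const_mul _)]
  exact lintegral_congr fun ω => (hf ω).2 η

/-- Expectations at the end of a run are quadratic forms in the initial state. -/
theorem hasDesignIdentity_expectation [NeZero d] (c : C) (L : List (Step C A M B))
    {f : (B.Idx → ℝ) → ℝ≥0∞} (hf : Measurable f) (x : A.Idx → ℝ) (y : M.Idx → ℝ) (z : B.Idx → ℝ)
    {Φ : EuclideanSpace ℂ (Fin d) → A.Basis → M.Basis → B.Basis → ℂ} (hΦ : IsLinearMap ℂ Φ) :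
    HasDesignIdentity fun ψ : UnitVector d => expectation c L f (x, y, z, Φ ψ.1) := by
  have hcont : ∀ {Φ : EuclideanSpace ℂ (Fin d) → A.Basis → M.Basis → B.Basis → ℂ},
      IsLinearMap ℂ Φ → ∀ a m b, IsLinearMap ℂ fun ψ => Φ ψ a m b := fun h a m b =>
    ⟨fun u v => by rw [h.map_add]; rfl, fun t u => by rw [h.map_smul]; rfl⟩
  have hmeas : ∀ {Φ : EuclideanSpace ℂ (Fin d) → A.Basis → M.Basis → B.Basis → ℂ},
      IsLinearMap ℂ Φ → Measurable fun ψ : UnitVector d => Φ ψ.1 := fun h =>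
    measurable_pi_lambda _ fun a => measurable_pi_lambda _ fun m => measurable_pi_lambda _ fun b =>
      (((hcont h a m b).mk' _).continuous_of_finiteDimensional.measurable).comp
        measurable_subtype_coe
  unfold expectation
  -- For a given outcome the new classical values do not depend on ψ; only the vector does, and
  -- linearly. Hence the induction runs over all classical values and all linear maps Φ.
  induction L generalizing x y z Φ with
  | nil =>
    refine HasDesignIdentity.mul_const (f := fun ψ => Config.weight (x, y, z, Φ ψ.1)) ?_ (f z)
    exact HasDesignIdentity.sum fun a => HasDesignIdentity.sum fun m => HasDesignIdentity.sum
      fun b => hasDesignIdentity_linear (hcont hΦ a m b)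
  | cons op L ih =>
    have hs : Measurable fun p : UnitVector d => ((x, y, z, Φ p.1) : Config A M B) :=
      measurable_const.prodMk (measurable_const.prodMk (measurable_const.prodMk (hmeas hΦ)))
    rcases op with op | op
    · refine HasDesignIdentity.lintegral ?_ fun ω => ?_
      · exact (measurable_total L (measurable_weight_mul hf)).comp (measurable_const.prodMk
          (measurable_actAlice op measurable_const measurable_snd (hs.comp measurable_fst)))
      · refine ih (op.newPriv c ω x y) (op.newMsgs c ω x y) z
          (Φ := fun ψ => op.evolve c ω x y (Φ ψ)) ⟨fun u v => ?_, fun t u => ?_⟩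
        · rw [hΦ.map_add, (op.isLinearMap_evolve c ω x y).map_add]
        · rw [hΦ.map_smul, (op.isLinearMap_evolve c ω x y).map_smul]
    · refine HasDesignIdentity.lintegral ?_ fun ω => ?_
      · exact (measurable_total L (measurable_weight_mul hf)).comp (measurable_const.prodMk
          (measurable_actBob op measurable_snd (hs.comp measurable_fst)))
      · have hlin := op.isLinearMap_evolve (Z := A.Basis) () ω z y
        refine ih x (op.newMsgs () ω z y) (op.newPriv () ω z y) (Φ := fun ψ a m b =>
          op.evolve () ω z y (fun b' m' a' => Φ ψ a' m' b') b m a) ⟨fun u v => ?_, fun t u => ?_⟩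
        · rw [hΦ.map_add]
          funext a m b
          exact congrFun (congrFun (congrFun (hlin.map_add (fun b m a => Φ u a m b)
            (fun b m a => Φ v a m b)) b) m) a
        · rw [hΦ.map_smul]
          funext a m b
          exact congrFun (congrFun (congrFun (hlin.map_smul t (fun b m a => Φ u a m b)) b) m) a

end Design

end Runs

/-! ### A dishonest Alice who pretends to know the state -/

section FixedParameter

variable {C : Type} [MeasurableSpace C] {A M B : Registers}

/-- The operation with its classical parameter fixed. -/
noncomputable def LocalOp.fixParam (c : C) (op : LocalOp C A M) : LocalOp Unit A M where
  loc := op.loc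
  priv := op.priv
  msgs := op.msgs
  Out := op.Out
  μ := op.μ
  kraus _ x ω := op.kraus c x ω
  measurable_kraus i j := (op.measurable_kraus i j).comp (measurable_const.prodMk measurable_snd)
  complete _ x v := op.complete c x v
  update _ x ω := op.update c x ω
  measurable_update := op.measurable_update.comp (measurable_const.prodMk measurable_snd)

/-- The steps of a run with Alice's classical parameter fixed. -/
noncomputable def fixParam (c : C) (L : List (Step C A M B)) : List (Step Unit A M B) :=
  L.map (Sum.map (LocalOp.fixParam c) id)

theorem total_fixParam (c : C) (L : List (Step C A M B)) (F : Config A M B → ℝ≥0∞)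
    (s : Config A M B) : total () (fixParam c L) F s = total c L F s := by
  induction L generalizing s with
  | nil => rfl
  | cons op L ih =>
    rcases op with op | op
    · exact lintegral_congr fun ω => ih _
    · exact lintegral_congr fun ω => ih _

theorem bobOps_fixParam (c : C) (L : List (Step C A M B)) : bobOps (fixParam c L) = bobOps L := by
  unfold bobOps fixParam
  rw [List.filterMap_map]
  congr 1
  funext op
  rcases op with op | op <;> rfl

theorem causal_fixParam {d : ℕ} [NeZero d] {sender : M.Idx → Party} {source : Spacetime}
    {L : List (Step C A M (B.adjoin d))} (c : C) (h : Causal sender source L) :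
    Causal sender source (fixParam c L) := by
  refine ⟨List.pairwise_map.2 (h.1.imp fun {s t} hst => ?_), fun op hop hn => ?_⟩
  · rcases s with s | s <;> rcases t with t | t <;> exact hst
  · obtain ⟨op' | op', h1, h2⟩ := List.mem_map.1 hop
    · cases h2
    · cases h2
      exact h.2 _ h1 hn

end FixedParameter

/-! ### The acceptance probability as a function of Bob's state and Alice's description -/

section Prob

theorem measurable_toPure {d : ℕ} : Measurable (toPure : UnitVector d → PureState d) := by
  refine Measurable.subtype_mk (measurable_pi_lambda _ fun i => measurable_pi_lambda _ fun j => ?_)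
  unfold projector
  exact Continuous.measurable (by fun_prop)

variable {d : ℕ} [NeZero d]

theorem isLinearMap_initial {A M B : Registers} (α : A.Basis → ℂ) (β : B.Basis → ℂ) :
    IsLinearMap ℂ fun (ψ : EuclideanSpace ℂ (Fin d)) (a : A.Basis) (m : M.Basis)
      (b : (B.adjoin d).Basis) => α a * (if ∀ i, (m i : ℕ) = 0 then 1 else 0) *
        (ψ (show Fin d from b (none : Option B.Idx)) *
          β (fun i => b (some i : Option B.Idx))) where
  map_add u v := by
    funext a m b
    simp only [PiLp.add_apply, Pi.add_apply]
    ring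
  map_smul t u := by
    funext a m b
    simp only [PiLp.smul_apply, Pi.smul_apply, smul_eq_mul]
    ring

theorem measurable_initial {A M B : Registers} (α : A.Basis → ℂ) (β : B.Basis → ℂ) :
    Measurable fun ψ : UnitVector d => (initial α β ψ : Config A M (B.adjoin d)) := by
  refine measurable_const.prodMk (measurable_const.prodMk (measurable_const.prodMk ?_))
  refine measurable_pi_lambda _ fun a => measurable_pi_lambda _ fun m =>
    measurable_pi_lambda _ fun b => ?_
  exact Continuous.measurable (by fun_prop)

/-- The initial vector is a tensor product of unit vectors, so its squared norm factors. -/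
theorem weight_initial {A M B : Registers} {α : A.Basis → ℂ} {β : B.Basis → ℂ}
    (hα : ∑ a, ‖α a‖ ^ 2 = 1) (hβ : ∑ b, ‖β b‖ ^ 2 = 1) (ψ : UnitVector d) :
    (initial α β ψ : Config A M (B.adjoin d)).weight = 1 := by
  have conv : ∀ {ι : Type} [Fintype ι] {f : ι → ℂ}, ∑ i, ‖f i‖ ^ 2 = 1 → ∑ i, ‖f i‖ₑ ^ 2 = 1 := by
    intro ι _ f h
    rw [← ENNReal.ofReal_one, ← h, ENNReal.ofReal_sum_of_nonneg (fun _ _ => by positivity)]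
    simp only [ENNReal.ofReal_pow (norm_nonneg _), ofReal_norm]
  have hψ : ∑ i, ‖ψ.1 i‖ ^ 2 = 1 := by
    rw [← EuclideanSpace.norm_sq_eq, norm_eq_of_mem_sphere, one_pow]
  have hM : ∑ m : M.Basis, ‖(if ∀ i, (m i : ℕ) = 0 then (1 : ℂ) else 0)‖ₑ ^ 2 = 1 := by
    rw [Finset.sum_eq_single fun i => ⟨0, M.dim_pos i⟩]
    · simp
    · intro m _ hm
      rw [if_neg fun h => hm (funext fun i => Fin.ext (h i))]
      simp
    · simp
  have hB : ∑ b : (B.adjoin d).Basis, ‖ψ.1 (show Fin d from b (none : Option B.Idx)) *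
      β (fun i => b (some i : Option B.Idx))‖ₑ ^ 2 = 1 := by
    rw [Fintype.sum_equiv (Equiv.piOptionEquivProd (β := fun i => Fin ((B.adjoin d).dim i))) _
      (fun p => ‖ψ.1 p.1‖ₑ ^ 2 * ‖β p.2‖ₑ ^ 2) fun b => by
        rw [enorm_mul, mul_pow]; rfl]
    rw [Fintype.sum_prod_type]
    simp_rw [← Finset.mul_sum]
    rw [conv hβ]
    simp only [mul_one]
    exact conv hψ
  simp only [Config.weight, initial, enorm_mul, mul_pow] at hB ⊢
  simp_rw [← Finset.mul_sum, hB, mul_one, ← Finset.mul_sum]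
  rw [hM]
  simp [conv hα]

namespace Protocol

variable (P : Protocol d)

theorem measurable_outcome {ι : Type*} (v : ι) (x : Outcome) :
    MeasurableSet {y : ι → ℝ | outcomeOf (y v) = x} := by
  have h : Measurable fun y : ι → ℝ => y v := measurable_pi_apply v
  have h0 : MeasurableSet {y : ι → ℝ | y v = 0} := h (measurableSet_singleton 0)
  have h1 : MeasurableSet {y : ι → ℝ | y v = 1} := h (measurableSet_singleton 1)
  cases x
  · convert h0 using 2
    unfold outcomeOf
    ext; split_ifs <;> simp_all
  · convert h1 using 2
    unfold outcomeOf
    ext; split_ifs <;> simp_all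
  · convert h0.compl.inter h1.compl using 1
    ext
    simp only [Set.mem_ofPred_eq, outcomeOf, Set.mem_inter_iff, Set.mem_compl_iff]
    split_ifs <;> simp_all

theorem measurable_prob (x : Outcome) :
    Measurable fun p : UnitVector d × UnitVector d => P.prob x p.1 p.2 := by
  refine (measurable_total P.steps (measurable_weight_mul ?_)).comp
    ((measurable_toPure.comp measurable_snd).prodMk
      ((measurable_initial P.initA P.initB).comp measurable_fst))
  exact measurable_one.indicator (measurable_outcome _ x)

/-- Alice's description η is held fixed, and ψ enters only through the initial vector, linearly. -/
theorem hasDesignIdentity_prob (x : Outcome) (η : UnitVector d) :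
    HasDesignIdentity fun ψ => P.prob x ψ η :=
  hasDesignIdentity_expectation (toPure η) P.steps
    (measurable_one.indicator (measurable_outcome _ x)) _ _ _
    (isLinearMap_initial P.initA P.initB)

/-- The strategy in which Alice behaves as if Bob's system were in the state `η`. -/
noncomputable def pretend (η : UnitVector d) : P.AliceStrategy where
  A := P.A
  init := P.initA
  init_unit := P.initA_unit
  steps := fixParam (toPure η) P.steps
  causal := causal_fixParam _ P.causal
  honestBob := bobOps_fixParam _ _

/-- For fixed η, pretending that the state is η is a strategy that needs no information about ψ. -/
theorem lintegral_prob_le_epsilonS (η : UnitVector d) :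
    ∫⁻ ψ, P.prob Outcome.accept ψ η ∂uniform d ≤ P.epsilonS := by
  refine le_trans (le_of_eq ?_) (le_iSup _ (P.pretend η))
  exact lintegral_congr fun ψ => (total_fixParam _ _ _ _).symm

end Protocol

end Prob

/-! ### A dishonest Bob who keeps his system and runs the protocol on a substitute -/

/-- Functions on the image of `S` in `Option ι` are functions on `S`. -/
def restrictSome {ι : Type*} (S : Finset ι) (β : Option ι → Type*) :
    (∀ i : S.map Function.Embedding.some, β i) ≃ ∀ i : S, β (some i) where
  toFun f i := f ⟨some i, Finset.mem_map_of_mem _ i.2⟩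
  invFun g
    | ⟨none, h⟩ => absurd h (by simp)
    | ⟨some i, h⟩ => g ⟨i, by simpa using h⟩
  left_inv f := by
    funext ⟨i, h⟩
    cases i with
    | none => exact absurd h (by simp)
    | some i => rfl
  right_inv g := rfl

namespace LocalOp

variable {C : Type} [MeasurableSpace C] {P M : Registers} (op : LocalOp C P M) (c : C) (ω : op.Out)
  (x : P.Idx → ℝ) (y : M.Idx → ℝ)

theorem newPriv_of_mem {i : P.Idx} (h : i ∈ op.priv) :
    op.newPriv c ω x y i = (op.update c (op.read x y) ω).1 ⟨i, h⟩ := dif_pos h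

theorem newPriv_of_notMem {i : P.Idx} (h : i ∉ op.priv) : op.newPriv c ω x y i = x i := dif_neg h

theorem newMsgs_of_notMem {i : M.Idx} (h : i ∉ op.msgs) : op.newMsgs c ω x y i = y i := dif_neg h

end LocalOp

/-! ### Runs with an additional untouched register of Bob's -/

section Adjoin

variable {A R M : Registers} (d : ℕ) [NeZero d]

/-- Basis labels of the registers of an operation, after a further register has been adjoined. -/
abbrev localBasisAdjoin (S : Finset R.Idx) (T : Finset M.Idx) :
    LocalBasis (R.adjoin d) M (S.map Function.Embedding.some) T ≃ LocalBasis R M S T :=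
  (restrictSome S fun i => Fin ((R.adjoin d).dim i)).prodCongr (Equiv.refl _)

/-- Classical values of the registers of an operation, after a further register has been
adjoined. -/
abbrev localDataAdjoin (S : Finset R.Idx) (T : Finset M.Idx) :
    LocalData (R.adjoin d) M (S.map Function.Embedding.some) T ≃ LocalData R M S T :=
  (restrictSome S fun _ => ℝ).prodCongr (Equiv.refl _)

theorem measurable_localDataAdjoin (S : Finset R.Idx) (T : Finset M.Idx) :
    Measurable (localDataAdjoin (R := R) d S T) :=
  (measurable_pi_lambda _ fun i : S => (measurable_pi_apply
    (⟨some i.1, Finset.mem_map_of_mem _ i.2⟩ : S.map Function.Embedding.some)).comp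
      measurable_fst).prodMk measurable_snd

theorem measurable_localDataAdjoin_symm (S : Finset R.Idx) (T : Finset M.Idx) :
    Measurable (localDataAdjoin (R := R) d S T).symm := by
  refine Measurable.prodMk (measurable_pi_lambda _ fun i => ?_) measurable_snd
  obtain ⟨i | i, h⟩ := i
  · exact absurd h (by simp)
  · exact (measurable_pi_apply (⟨i, by simpa using h⟩ : S)).comp measurable_fst

/-- The operation as one on a family with one more register, which it does not touch. -/
noncomputable def LocalOp.adjoin (op : LocalOp Unit R M) : LocalOp Unit (R.adjoin d) M where
  loc := op.loc
  priv := op.priv.map Function.Embedding.some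
  msgs := op.msgs
  Out := op.Out
  μ := op.μ
  kraus _ x ω := (op.kraus () (localDataAdjoin d op.priv op.msgs x) ω).submatrix
    (localBasisAdjoin d op.priv op.msgs) (localBasisAdjoin d op.priv op.msgs)
  measurable_kraus i j := (op.measurable_kraus _ _).comp (measurable_const.prodMk
    (((measurable_localDataAdjoin d _ _).comp measurable_snd.fst).prodMk measurable_snd.snd))
  complete _ x v := by
    refine Eq.trans (lintegral_congr fun ω => ?_) ((op.complete ()
      (localDataAdjoin d op.priv op.msgs x)
      (v ∘ (localBasisAdjoin d op.priv op.msgs).symm)).trans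
        ((localBasisAdjoin d op.priv op.msgs).symm.sum_comp fun i => ‖v i‖ₑ ^ 2))
    rw [← (localBasisAdjoin d op.priv op.msgs).sum_comp]
    refine Finset.sum_congr rfl fun i _ => ?_
    rw [Matrix.submatrix_mulVec_equiv]
    rfl
  update _ x ω := (localDataAdjoin d op.priv op.msgs).symm
    (op.update () (localDataAdjoin d op.priv op.msgs x) ω)
  measurable_update := (measurable_localDataAdjoin_symm d _ _).comp
    (op.measurable_update.comp (measurable_const.prodMk
      (((measurable_localDataAdjoin d _ _).comp measurable_snd.fst).prodMk measurable_snd.snd)))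

variable {d}

/-- A configuration with a further register of Bob's, in the state `v` and with the value `r`. -/
def Config.adjoin (v : Fin d → ℂ) (r : ℝ) (s : Config A M R) : Config A M (R.adjoin d) :=
  (s.1, s.2.1, fun i => Option.elim i r s.2.2.1, fun a m b =>
    v (show Fin d from b (none : Option R.Idx)) *
      s.2.2.2 a m fun i => b (some i : Option R.Idx))

theorem sum_basis_adjoin {α : Type*} [AddCommMonoid α] (G : (R.adjoin d).Basis → α) :
    ∑ b, G b = ∑ q : Fin d, ∑ b : R.Basis,
      G ((Equiv.piOptionEquivProd (β := fun i => Fin ((R.adjoin d).dim i))).symm (q, b)) := by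
  rw [← Fintype.sum_prod_type']
  exact Fintype.sum_equiv (Equiv.piOptionEquivProd (β := fun i => Fin ((R.adjoin d).dim i))) _ _
    fun b => congrArg G (Equiv.symm_apply_apply _ b).symm

theorem weight_adjoin (v : Fin d → ℂ) (r : ℝ) (s : Config A M R) :
    (s.adjoin v r).weight = (∑ q, ‖v q‖ₑ ^ 2) * s.weight := by
  simp only [Config.weight, Config.adjoin, Finset.mul_sum]
  refine Finset.sum_congr rfl fun a _ => Finset.sum_congr rfl fun m _ => ?_
  rw [sum_basis_adjoin, Finset.sum_comm]
  refine Finset.sum_congr rfl fun b _ => ?_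
  rw [Finset.sum_mul]
  refine Finset.sum_congr rfl fun q _ => ?_
  rw [enorm_mul, mul_pow]
  rfl

theorem lift_adjoin (op : LocalOp Unit R M)
    (K : Matrix (LocalBasis R M op.priv op.msgs) (LocalBasis R M op.priv op.msgs) ℂ)
    (b : (R.adjoin d).Basis) (m : M.Basis) (b' : (R.adjoin d).Basis) (m' : M.Basis) :
    (op.adjoin d).lift (K.submatrix (localBasisAdjoin d op.priv op.msgs)
      (localBasisAdjoin d op.priv op.msgs)) b m b' m' =
    if b (none : Option R.Idx) = b' (none : Option R.Idx) then
      op.lift K (fun i => b (some i : Option R.Idx)) m (fun i => b' (some i : Option R.Idx)) m'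
    else 0 := by
  have hiff : (∀ i, i ∉ (op.adjoin d).priv → b i = b' i) ↔
      b (none : Option R.Idx) = b' (none : Option R.Idx) ∧
        ∀ i, i ∉ op.priv → b (some i : Option R.Idx) = b' (some i : Option R.Idx) := by
    constructor
    · intro h
      exact ⟨h _ (by simp [LocalOp.adjoin]), fun i hi => h _ (by simpa [LocalOp.adjoin] using hi)⟩
    · rintro ⟨h1, h2⟩ (_ | i) hi
      · exact h1
      · exact h2 i (by simpa [LocalOp.adjoin] using hi)
  unfold LocalOp.lift
  by_cases h0 : b (none : Option R.Idx) = b' (none : Option R.Idx)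
  · rw [if_pos h0]
    by_cases h1 : (∀ i, i ∉ op.priv → b (some i : Option R.Idx) = b' (some i : Option R.Idx)) ∧
        ∀ i, i ∉ op.msgs → m i = m' i
    · rw [if_pos h1, if_pos ⟨hiff.2 ⟨h0, h1.1⟩, h1.2⟩]
      rfl
    · rw [if_neg h1, if_neg fun h => h1 ⟨(hiff.1 h.1).2, h.2⟩]
  · rw [if_neg h0, if_neg fun h => h0 (hiff.1 h.1).1]

/-- The enlarged operator is 1 ⊗ K, so it keeps the product form and the factor v. -/
theorem evolve_adjoin {Z : Type} (op : LocalOp Unit R M) (ω : op.Out) (v : Fin d → ℂ) (r : ℝ)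
    (x : R.Idx → ℝ) (y : M.Idx → ℝ) (ψ : R.Basis → M.Basis → Z → ℂ) (b : (R.adjoin d).Basis)
    (m : M.Basis) (z : Z) :
    (op.adjoin d).evolve () ω (fun i => Option.elim i r x) y
      (fun b' m' z' => v (show Fin d from b' (none : Option R.Idx)) *
        ψ (fun i => b' (some i : Option R.Idx)) m' z') b m z =
    v (show Fin d from b (none : Option R.Idx)) *
      op.evolve () ω x y ψ (fun i => b (some i : Option R.Idx)) m z := by
  unfold LocalOp.evolve
  rw [sum_basis_adjoin, Finset.sum_eq_single (show Fin d from b (none : Option R.Idx))]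
  · rw [Finset.mul_sum]
    refine Finset.sum_congr rfl fun b' _ => ?_
    rw [Finset.mul_sum]
    refine Finset.sum_congr rfl fun m' _ => ?_
    rw [mul_left_comm]
    refine congrArg₂ (· * ·) rfl (congrArg₂ (· * ·) ?_ rfl)
    exact (lift_adjoin op _ _ _ _ _).trans (if_pos rfl)
  · intro q _ hq
    refine Finset.sum_eq_zero fun b' _ => Finset.sum_eq_zero fun m' _ => ?_
    refine mul_eq_zero_of_left ?_ _
    exact (lift_adjoin op _ _ _ _ _).trans (if_neg fun h => hq h.symm)
  · simp

theorem newPriv_adjoin (op : LocalOp Unit R M) (ω : op.Out) (r : ℝ)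
    (x : R.Idx → ℝ) (y : M.Idx → ℝ) :
    (op.adjoin d).newPriv () ω (fun i => Option.elim i r x) y =
      fun i => Option.elim i r (op.newPriv () ω x y) := by
  funext i
  cases i with
  | none => exact LocalOp.newPriv_of_notMem _ _ _ _ _ (by simp [LocalOp.adjoin])
  | some i =>
    have hmem : some i ∈ (op.adjoin d).priv ↔ i ∈ op.priv := by simp [LocalOp.adjoin]
    by_cases hi : i ∈ op.priv
    · exact (LocalOp.newPriv_of_mem _ _ _ _ _ (hmem.2 hi)).trans
        (op.newPriv_of_mem () ω x y hi).symm
    · exact (LocalOp.newPriv_of_notMem _ _ _ _ _ (mt hmem.1 hi)).trans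
        (op.newPriv_of_notMem () ω x y hi).symm

theorem actBob_adjoin (op : LocalOp Unit R M) (ω : op.Out) (v : Fin d → ℂ) (r : ℝ)
    (s : Config A M R) :
    actBob (op.adjoin d) ω (s.adjoin v r) = (actBob op ω s).adjoin v r :=
  Prod.ext rfl (Prod.ext rfl (Prod.ext (newPriv_adjoin op ω r s.2.2.1 s.2.1)
    (funext fun a => funext fun m => funext fun b =>
      evolve_adjoin op ω v r s.2.2.1 s.2.1 (fun b m a => s.2.2.2 a m b) b m a)))

theorem actAlice_adjoin {C : Type} [MeasurableSpace C] (op : LocalOp C A M) (c : C) (ω : op.Out)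
    (v : Fin d → ℂ) (r : ℝ) (s : Config A M R) :
    actAlice op c ω (s.adjoin v r) = (actAlice op c ω s).adjoin v r := by
  refine Prod.ext rfl (Prod.ext rfl (Prod.ext rfl ?_))
  funext a m b
  change op.evolve c ω _ _ _ a m b = v _ * op.evolve c ω _ _ _ a m _
  unfold LocalOp.evolve
  rw [Finset.mul_sum]
  refine Finset.sum_congr rfl fun b' _ => ?_
  rw [Finset.mul_sum]
  refine Finset.sum_congr rfl fun m' _ => ?_
  rw [mul_left_comm]
  rfl

variable {C : Type} [MeasurableSpace C]

/-- The steps of a run, with a further register of Bob's that is not touched. -/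
noncomputable def adjoinSteps (d : ℕ) [NeZero d] (L : List (Step C A M R)) :
    List (Step C A M (R.adjoin d)) :=
  L.map (Sum.map id (LocalOp.adjoin d))

theorem total_adjoinSteps (c : C) (L : List (Step C A M R)) (F : Config A M (R.adjoin d) → ℝ≥0∞)
    (v : Fin d → ℂ) (r : ℝ) (s : Config A M R) :
    total c (adjoinSteps d L) F (s.adjoin v r) = total c L (fun t => F (t.adjoin v r)) s := by
  induction L generalizing s with
  | nil => rfl
  | cons op L ih =>
    rcases op with op | op
    · refine lintegral_congr fun ω => ?_
      exact (congrArg _ (actAlice_adjoin op c ω v r s)).trans (ih _)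
    · refine lintegral_congr fun ω => ?_
      exact (congrArg _ (actBob_adjoin op ω v r s)).trans (ih _)

/-- The vector v is not assumed normalized: after a measurement of the extra register, its squared
norm is the probability of the result and multiplies the whole expectation. -/
theorem expectation_adjoinSteps (c : C) (L : List (Step C A M R))
    {f : ((R.adjoin d).Idx → ℝ) → ℝ≥0∞} (hf : Measurable f)
    (v : Fin d → ℂ) (r : ℝ) (s : Config A M R) :
    expectation c (adjoinSteps d L) f (s.adjoin v r) =
      (∑ q, ‖v q‖ₑ ^ 2) *
        expectation c L (fun z => f (fun i : Option R.Idx => Option.elim i r z)) s := by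
  have hm : Measurable fun z : R.Idx → ℝ =>
      f (fun i : Option R.Idx => Option.elim i r z) := by
    refine hf.comp (measurable_pi_lambda _ fun i => ?_)
    cases i with
    | none => exact measurable_const
    | some i => exact measurable_pi_apply i
  unfold expectation
  rw [total_adjoinSteps, mul_comm, ← total_mul_const c L (measurable_weight_mul hm)]
  congr 1
  funext t
  rw [weight_adjoin, mul_assoc, mul_comm]
  rfl

theorem aliceOps_adjoinSteps (L : List (Step C A M R)) :
    aliceOps (adjoinSteps d L) = aliceOps L := by
  unfold aliceOps adjoinSteps
  rw [List.filterMap_map]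
  congr 1
  funext op
  rcases op with op | op <;> rfl

theorem pairwise_adjoinSteps {sender : M.Idx → Party} {L : List (Step C A M R)}
    (h : L.Pairwise (Compatible sender)) : (adjoinSteps d L).Pairwise (Compatible sender) := by
  refine List.pairwise_map.2 (h.imp fun {s t} hst => ?_)
  rcases s with s | s <;> rcases t with t | t
  · exact hst
  · exact hst
  · exact hst
  · exact hst.imp_left fun h => ⟨(Finset.disjoint_map _).2 h.1, h.2⟩

end Adjoin

/-! ### Measuring the additional register in an orthonormal basis -/

section Measure

variable {d : ℕ} [NeZero d] {A R M : Registers}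

/-- Basis labels of the adjoined register. -/
def localBasisNone : LocalBasis (R.adjoin d) M {(none : Option R.Idx)} ∅ ≃ Fin d where
  toFun p := p.1 ⟨none, Finset.mem_singleton_self _⟩
  invFun q := (fun i => match i with
    | ⟨none, _⟩ => q
    | ⟨some i, h⟩ => absurd (Finset.mem_singleton.1 h) (by simp), fun i => absurd i.2 (Finset.notMem_empty _))
  left_inv p := by
    refine Prod.ext (funext fun i => ?_) (funext fun i => absurd i.2 (Finset.notMem_empty _))
    obtain ⟨i | i, h⟩ := i
    · rfl
    · exact absurd (Finset.mem_singleton.1 h) (by simp)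
  right_inv q := rfl

/-- The projector onto a vector of an orthonormal basis, on the adjoined register. -/
noncomputable def measureKraus (R M : Registers)
    (b : OrthonormalBasis (Fin d) ℂ (EuclideanSpace ℂ (Fin d))) (ω : Fin d) :
    Matrix (LocalBasis (R.adjoin d) M {(none : Option R.Idx)} ∅)
      (LocalBasis (R.adjoin d) M {(none : Option R.Idx)} ∅) ℂ :=
  Matrix.of fun p q => b ω (localBasisNone p) * star (b ω (localBasisNone q))

/-- Measurement of the adjoined register in an orthonormal basis. -/
noncomputable def measureOp (R M : Registers) (source : Spacetime)
    (b : OrthonormalBasis (Fin d) ℂ (EuclideanSpace ℂ (Fin d))) :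
    LocalOp Unit (R.adjoin d) M where
  loc := source
  priv := {(none : Option R.Idx)}
  msgs := ∅
  Out := Fin d
  μ := Measure.count
  kraus _ _ ω := measureKraus R M b ω
  measurable_kraus i j := by
    refine (measurable_from_top (f := fun ω : Fin d => measureKraus R M b ω i j)).comp measurable_snd.snd
  complete _ x v := by
    let w : EuclideanSpace ℂ (Fin d) := WithLp.toLp 2 fun q => v (localBasisNone.symm q)
    have hK : ∀ ω p, (measureKraus R M b ω).mulVec v p =
        b ω (localBasisNone p) * inner ℂ (b ω) w := by
      intro ω p
      simp only [measureKraus, Matrix.mulVec, dotProduct, Matrix.of_apply, mul_assoc, ← Finset.mul_sum]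
      congr 1
      rw [← (localBasisNone (d := d) (R := R) (M := M)).symm.sum_comp]
      simp [w, PiLp.inner_apply, mul_comm]
    rw [lintegral_count, tsum_fintype]
    simp_rw [hK, enorm_mul, mul_pow, ← Finset.sum_mul]
    have h1 : ∀ ω, ∑ p : LocalBasis (R.adjoin d) M {(none : Option R.Idx)} ∅,
        ‖b ω (localBasisNone p)‖ₑ ^ 2 = 1 := by
      intro ω
      rw [(localBasisNone (d := d) (R := R) (M := M)).sum_comp fun q => ‖b ω q‖ₑ ^ 2, sum_enorm_sq]
      simp
    simp_rw [h1, one_mul]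
    rw [← (localBasisNone (d := d) (R := R) (M := M)).symm.sum_comp]
    refine Eq.trans ?_ (sum_enorm_sq w).symm
    rw [← b.sum_sq_norm_inner_right w, ENNReal.ofReal_sum_of_nonneg (fun _ _ => by positivity)]
    simp only [ENNReal.ofReal_pow (norm_nonneg _), ofReal_norm]
  update _ x ω := (fun _ => ((ω : ℕ) : ℝ), x.2)
  measurable_update := by
    refine Measurable.prodMk (measurable_pi_lambda _ fun _ => ?_) measurable_snd.fst.snd
    exact (measurable_from_top (f := fun ω : Fin d => ((ω : ℕ) : ℝ))).comp measurable_snd.snd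

theorem lift_measureOp (source : Spacetime)
    (e : OrthonormalBasis (Fin d) ℂ (EuclideanSpace ℂ (Fin d))) (ω : Fin d)
    (b : (R.adjoin d).Basis) (m : M.Basis) (b' : (R.adjoin d).Basis) (m' : M.Basis) :
    (measureOp R M source e).lift (measureKraus R M e ω) b m b' m' =
      if (fun i => b (some i : Option R.Idx)) = (fun i => b' (some i : Option R.Idx)) then
        if m = m' then e ω (show Fin d from b (none : Option R.Idx)) *
          star (e ω (show Fin d from b' (none : Option R.Idx))) else 0 else 0 := by
  have h1 : (∀ i, i ∉ (measureOp R M source e).priv → b i = b' i) ↔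
      (fun i => b (some i : Option R.Idx)) = fun i => b' (some i : Option R.Idx) := by
    constructor
    · intro h
      exact funext fun i => h _ fun hi => Option.some_ne_none i (Finset.mem_singleton.1 hi)
    · rintro h (_ | i) hi
      · exact absurd (Finset.mem_singleton_self _) hi
      · exact congrFun h i
  have h2 : (∀ i, i ∉ (measureOp R M source e).msgs → m i = m' i) ↔ m = m' :=
    ⟨fun h => funext fun i => h i (Finset.notMem_empty _), fun h i _ => congrFun h i⟩
  unfold LocalOp.lift
  by_cases hb : (fun i => b (some i : Option R.Idx)) = fun i => b' (some i : Option R.Idx)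
  · by_cases hm : m = m'
    · rw [if_pos ⟨h1.2 hb, h2.2 hm⟩, if_pos hb, if_pos hm]
      rfl
    · rw [if_neg fun h => hm (h2.1 h.2), if_pos hb, if_neg hm]
  · rw [if_neg fun h => hb (h1.1 h.1), if_neg hb]

theorem evolve_measureOp {Z : Type} (source : Spacetime)
    (e : OrthonormalBasis (Fin d) ℂ (EuclideanSpace ℂ (Fin d))) (ω : Fin d)
    (v : EuclideanSpace ℂ (Fin d)) (x : (R.adjoin d).Idx → ℝ) (y : M.Idx → ℝ)
    (ψ : R.Basis → M.Basis → Z → ℂ) (b : (R.adjoin d).Basis) (m : M.Basis) (z : Z) :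
    (measureOp R M source e).evolve () ω x y
      (fun b' m' z' => v (show Fin d from b' (none : Option R.Idx)) *
        ψ (fun i => b' (some i : Option R.Idx)) m' z') b m z =
    inner ℂ (e ω) v * e ω (show Fin d from b (none : Option R.Idx)) *
      ψ (fun i => b (some i : Option R.Idx)) m z := by
  have h : ∀ (q : Fin d) (b' : R.Basis) (m' : M.Basis),
      (measureOp R M source e).lift (measureKraus R M e ω) b m
        ((Equiv.piOptionEquivProd (β := fun i => Fin ((R.adjoin d).dim i))).symm (q, b')) m' =
      if (fun i => b (some i : Option R.Idx)) = b' then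
        if m = m' then e ω (show Fin d from b (none : Option R.Idx)) * star (e ω q) else 0 else 0 :=
    fun q b' m' => lift_measureOp source e ω b m _ m'
  unfold LocalOp.evolve
  rw [sum_basis_adjoin]
  have hq : ∀ q : Fin d, ∑ b' : R.Basis, ∑ m' : M.Basis,
      (measureOp R M source e).lift (measureKraus R M e ω) b m
        ((Equiv.piOptionEquivProd (β := fun i => Fin ((R.adjoin d).dim i))).symm (q, b')) m' *
        (v q * ψ b' m' z) = e ω (show Fin d from b (none : Option R.Idx)) * star (e ω q) *
        (v q * ψ (fun i => b (some i : Option R.Idx)) m z) := by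
    intro q
    rw [Finset.sum_eq_single fun i => b (some i : Option R.Idx),
      Finset.sum_eq_single m, h, if_pos rfl, if_pos rfl]
    · intro m' _ hm
      rw [h, if_pos rfl, if_neg hm.symm, zero_mul]
    · simp
    · intro b' _ hb
      refine Finset.sum_eq_zero fun m' _ => ?_
      rw [h, if_neg hb.symm, zero_mul]
    · simp
  refine (Finset.sum_congr rfl fun q _ => hq q).trans ?_
  rw [PiLp.inner_apply, Finset.sum_mul, Finset.sum_mul]
  refine Finset.sum_congr rfl fun q _ => ?_
  simp only [RCLike.inner_apply, RCLike.star_def]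
  ring

/-- A rank-one projector on the extra factor leaves a product state, so the rest of the run is that
of an untouched register, now with the result stored as its classical value. -/
theorem actBob_measureOp (source : Spacetime)
    (e : OrthonormalBasis (Fin d) ℂ (EuclideanSpace ℂ (Fin d))) (ω : Fin d)
    (v : EuclideanSpace ℂ (Fin d)) (r : ℝ) (s : Config A M R) :
    actBob (measureOp R M source e) ω (s.adjoin v r) =
      s.adjoin (fun q => inner ℂ (e ω) v * e ω q) ((ω : ℕ) : ℝ) := by
  set x : (R.adjoin d).Idx → ℝ := fun i => Option.elim i r s.2.2.1
  refine Prod.ext rfl (Prod.ext (funext fun i => (measureOp R M source e).newMsgs_of_notMem () ω x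
    s.2.1 (Finset.notMem_empty i)) (Prod.ext (funext fun i => ?_) ?_))
  · cases i with
    | none =>
      exact (measureOp R M source e).newPriv_of_mem () ω x s.2.1 (Finset.mem_singleton_self _)
    | some i =>
      exact (measureOp R M source e).newPriv_of_notMem () ω x s.2.1 fun hi =>
        Option.some_ne_none i (Finset.mem_singleton.1 hi)
  · exact funext fun a => funext fun m => funext fun b =>
      evolve_measureOp source e ω v _ s.2.1 (fun b m a => s.2.2.2 a m b) b m a

end Measure

/-! ### The score of the substitution attack and its consequences -/

section Estimate

variable {d : ℕ} [NeZero d]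

theorem uniform_fidelity_sq (g : UnitVector d) :
    ∫⁻ η, fidelity g η * fidelity g η ∂uniform d = ENNReal.ofReal (2 / (d * (d + 1))) := by
  have h := lintegral_inner_mul_fidelity g.1 g
  rw [inner_self_eq_norm_sq_to_K, norm_eq_of_mem_sphere] at h
  refine h.trans (congrArg _ ?_)
  rw [div_mul_eq_mul_div]
  congr 1
  simp
  norm_num

/-- The vectors of an orthonormal basis as unit vectors. -/
noncomputable def basisVector (e : OrthonormalBasis (Fin d) ℂ (EuclideanSpace ℂ (Fin d)))
    (i : Fin d) : UnitVector d :=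
  ⟨e i, by simp⟩

namespace Protocol

variable (P : Protocol d)

open Classical in
/-- Bob's guess: the measured basis vector `e i`, except that it is `h` if `i = 0` and the outcome
is accept. -/
noncomputable def guessFromValues (e : OrthonormalBasis (Fin d) ℂ (EuclideanSpace ℂ (Fin d)))
    (h : UnitVector d) (y : Option (Option P.B.Idx) → ℝ) : UnitVector d :=
  if outcomeOf (y (some (some P.verdict))) = Outcome.accept ∧ y none = 0 then h
  -- Floor and reduction mod d decode the stored index; on values that are not an index below d they
  -- only make the guess total.
  else basisVector e (Fin.ofNat d ⌊y none⌋₊)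

theorem measurable_guessFromValues (e : OrthonormalBasis (Fin d) ℂ (EuclideanSpace ℂ (Fin d)))
    (h : UnitVector d) : Measurable (P.guessFromValues e h) := by
  refine Measurable.ite ((measurable_outcome _ _).inter
    (measurable_pi_apply (none : Option (Option P.B.Idx)) (measurableSet_singleton 0)))
    measurable_const ?_
  exact (measurable_from_top (f := fun n : ℕ => basisVector e (Fin.ofNat d n))).comp
    (Nat.measurable_floor.comp (measurable_pi_apply _))

/-- The measurement sits at the source itself and shares no register with the later steps, which no
longer touch the real system. -/
theorem causal_measure_adjoin (e : OrthonormalBasis (Fin d) ℂ (EuclideanSpace ℂ (Fin d))) :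
    Causal (B := P.B.adjoin d) P.sender P.source
      (Sum.inr (measureOp (P.B.adjoin d) P.M P.source e) :: adjoinSteps d P.steps) := by
  refine ⟨List.pairwise_cons.2 ⟨fun t ht => ?_, pairwise_adjoinSteps P.causal.1⟩,
    fun op hop hn => ?_⟩
  · obtain ⟨op | op, -, rfl⟩ := List.mem_map.1 ht
    · intro m hm
      exact absurd hm (Finset.notMem_empty m)
    · refine Or.inl ⟨Finset.disjoint_left.2 fun i hi hi' => ?_, Finset.disjoint_empty_left _⟩
      rw [Finset.mem_singleton.1 hi] at hi'
      simp [LocalOp.adjoin] at hi'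
  · rcases List.mem_cons.1 hop with h | h
    · cases h
      simp [Precedes, measureOp]
    · obtain ⟨op' | op', -, h2⟩ := List.mem_map.1 h
      · cases h2
      · cases h2
        simp [LocalOp.adjoin] at hn

/-- The strategy in which Bob measures his system in an orthonormal basis and runs the protocol on
a substitute in the state `ψ`. -/
noncomputable def substitute (e : OrthonormalBasis (Fin d) ℂ (EuclideanSpace ℂ (Fin d)))
    (h ψ : UnitVector d) : P.BobStrategy where
  -- The substitute becomes one of Bob's private registers. A strategy adjoins the real system once
  -- more, so `none` is the real system, `some none` the substitute.
  B := P.B.adjoin d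
  init b := ψ.1 (show Fin d from b (none : Option P.B.Idx)) *
    P.initB fun i => b (some i : Option P.B.Idx)
  init_unit := by
    rw [sum_basis_adjoin]
    have : ∀ (q : Fin d) (b : P.B.Basis), ‖ψ.1 q * P.initB b‖ ^ 2 = ‖ψ.1 q‖ ^ 2 * ‖P.initB b‖ ^ 2 :=
      fun q b => by rw [norm_mul, mul_pow]
    refine (Finset.sum_congr rfl fun q _ => Finset.sum_congr rfl fun b _ => this q b).trans ?_
    simp_rw [← Finset.mul_sum, P.initB_unit, mul_one]
    rw [← EuclideanSpace.norm_sq_eq, norm_eq_of_mem_sphere, one_pow]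
  steps := Sum.inr (measureOp (P.B.adjoin d) P.M P.source e) :: adjoinSteps d P.steps
  causal := P.causal_measure_adjoin e
  honestAlice := aliceOps_adjoinSteps P.steps
  guess := P.guessFromValues e h
  measurable_guess := P.measurable_guessFromValues e h

theorem prob_add_prob_compl (ψ η : UnitVector d) :
    P.prob Outcome.accept ψ η + expectation (toPure η) P.steps
      (Set.indicator {y | outcomeOf (y (some P.verdict : Option P.B.Idx)) = Outcome.accept}ᶜ 1)
      (initial P.initA P.initB ψ) = 1 := by
  rw [prob, expectation, expectation, ← total_add _ _ (measurable_weight_mul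
    (measurable_one.indicator (measurable_outcome _ _))), ← weight_initial P.initA_unit P.initB_unit
    ψ (M := P.M), ← total_weight (toPure η) P.steps]
  congr 1
  funext t
  rw [← mul_add, ← Pi.add_apply, Set.indicator_self_add_compl, Pi.one_apply, mul_one]

theorem prob_le_one (ψ η : UnitVector d) : P.prob Outcome.accept ψ η ≤ 1 :=
  le_self_add.trans_eq (P.prob_add_prob_compl ψ η)

/-- The real system stays in a product with everything else, so the result i occurs with the Born
weight F(eᵢ, η), independently of the simulated run. -/
theorem expectation_substitute (e : OrthonormalBasis (Fin d) ℂ (EuclideanSpace ℂ (Fin d)))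
    (h ψ η : UnitVector d) :
    expectation (toPure η) (P.substitute e h ψ).steps
      (fun y => fidelity ((P.substitute e h ψ).guess y) η)
      (initial P.initA (P.substitute e h ψ).init η) =
    ∑ i, fidelity (basisVector e i) η * expectation (toPure η) P.steps
      (fun z => fidelity (P.guessFromValues e h
        (fun j => Option.elim j ((i : ℕ) : ℝ) z)) η) (initial P.initA P.initB ψ) := by
  have hinit : (initial P.initA (P.substitute e h ψ).init η :
      Config P.A P.M ((P.B.adjoin d).adjoin d)) =
      (initial P.initA P.initB ψ : Config P.A P.M (P.B.adjoin d)).adjoin η.1 0 := by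
    refine Prod.ext rfl (Prod.ext rfl (Prod.ext ?_ ?_))
    · funext i
      cases i <;> rfl
    · funext a m b
      exact mul_left_comm _ _ _
  have hf : Measurable fun y => fidelity (P.guessFromValues e h y) η :=
    (measurable_fidelity_left η).comp (P.measurable_guessFromValues e h)
  have hstep : expectation (toPure η) (P.substitute e h ψ).steps
      (fun y => fidelity ((P.substitute e h ψ).guess y) η)
      (initial P.initA (P.substitute e h ψ).init η) =
      ∫⁻ i : Fin d, expectation (toPure η) (adjoinSteps d P.steps)
        (fun y => fidelity (P.guessFromValues e h y) η)
        (actBob (measureOp (P.B.adjoin d) P.M P.source e) i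
          ((initial P.initA P.initB ψ : Config P.A P.M (P.B.adjoin d)).adjoin η.1 0))
        ∂Measure.count :=
    congrArg (expectation (toPure η) (P.substitute e h ψ).steps
      fun y => fidelity ((P.substitute e h ψ).guess y) η) hinit
  rw [hstep, lintegral_count, tsum_fintype]
  refine Finset.sum_congr rfl fun i _ => ?_
  rw [actBob_measureOp]
  refine (expectation_adjoinSteps (toPure η) P.steps hf _ _ _).trans (congrArg₂ (· * ·) ?_ rfl)
  simp_rw [enorm_mul, mul_pow]
  rw [← Finset.mul_sum, sum_enorm_sq]
  simp [fidelity, basisVector]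

/-- Relative to always guessing the measured vector, only result 0 with acceptance changes, from e₀
to h. The loss is added on the left to avoid subtraction in `ℝ≥0∞`. -/
theorem expectation_substitute_add (e : OrthonormalBasis (Fin d) ℂ (EuclideanSpace ℂ (Fin d)))
    (h ψ η : UnitVector d) :
    expectation (toPure η) (P.substitute e h ψ).steps
      (fun y => fidelity ((P.substitute e h ψ).guess y) η)
      (initial P.initA (P.substitute e h ψ).init η) +
        P.prob Outcome.accept ψ η *
          (fidelity (basisVector e 0) η * fidelity (basisVector e 0) η) =
      P.prob Outcome.accept ψ η * (fidelity (basisVector e 0) η * fidelity h η) +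
        ∑ i, fidelity (basisVector e i) η * fidelity (basisVector e i) η := by
  have hconst : ∀ r : ℝ≥0∞, expectation (toPure η) P.steps (fun _ => r)
      (initial P.initA P.initB ψ) = r := by
    intro r
    rw [expectation, total_mul_const _ _ measurable_weight, total_weight,
      weight_initial P.initA_unit P.initB_unit, one_mul]
  have hfloor : ∀ i : Fin d, Fin.ofNat d ⌊((i : ℕ) : ℝ)⌋₊ = i := by
    intro i
    rw [Nat.floor_natCast]
    exact Fin.ofNat_val_eq_self i
  set S : Set (Option P.B.Idx → ℝ) :=
    {y | outcomeOf (y (some P.verdict : Option P.B.Idx)) = Outcome.accept} with hS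
  have hSm : MeasurableSet S := measurable_outcome _ _
  have hne : ∀ i : Fin d, i ≠ 0 → expectation (toPure η) P.steps
      (fun z => fidelity (P.guessFromValues e h
        (fun j => Option.elim j ((i : ℕ) : ℝ) z)) η) (initial P.initA P.initB ψ) =
      fidelity (basisVector e i) η := by
    intro i hi
    rw [← hconst (fidelity (basisVector e i) η)]
    congr 1
    funext z
    rw [guessFromValues, if_neg, Option.elim_none, hfloor]
    rintro ⟨-, h0⟩
    rw [Option.elim_none, Nat.cast_eq_zero] at h0
    exact hi (Fin.ext h0)
  have h0 : expectation (toPure η) P.steps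
      (fun z => fidelity (P.guessFromValues e h
        (fun j => Option.elim j (((0 : Fin d) : ℕ) : ℝ) z)) η) (initial P.initA P.initB ψ) =
      P.prob Outcome.accept ψ η * fidelity h η + expectation (toPure η) P.steps (Set.indicator Sᶜ 1)
        (initial P.initA P.initB ψ) * fidelity (basisVector e 0) η := by
    rw [prob, ← hS, expectation, expectation, expectation,
      ← total_mul_const _ _ (measurable_weight_mul (measurable_one.indicator hSm)),
      ← total_mul_const _ _ (measurable_weight_mul (measurable_one.indicator hSm.compl)),
      ← total_add _ _ ((measurable_weight_mul (measurable_one.indicator hSm)).mul_const _)]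
    congr 1
    funext t
    by_cases ht : t.2.2.1 ∈ S
    · have : P.guessFromValues e h (fun j => Option.elim j (((0 : Fin d) : ℕ) : ℝ) t.2.2.1) = h :=
        if_pos ⟨ht, by simp⟩
      rw [this, Set.indicator_of_mem ht, Set.indicator_of_notMem (Set.notMem_compl_iff.2 ht)]
      simp
    · have : P.guessFromValues e h (fun j => Option.elim j (((0 : Fin d) : ℕ) : ℝ) t.2.2.1) =
          basisVector e 0 := by
        rw [guessFromValues, if_neg fun h => ht h.1, Option.elim_none, hfloor]
      rw [this, Set.indicator_of_notMem ht, Set.indicator_of_mem ht]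
      simp
  have hs : ∑ i ∈ Finset.univ.erase (0 : Fin d), fidelity (basisVector e i) η *
      expectation (toPure η) P.steps (fun z => fidelity (P.guessFromValues e h
        (fun j => Option.elim j ((i : ℕ) : ℝ) z)) η) (initial P.initA P.initB ψ) =
      ∑ i ∈ Finset.univ.erase (0 : Fin d),
        fidelity (basisVector e i) η * fidelity (basisVector e i) η :=
    Finset.sum_congr rfl fun i hi => by rw [hne i (Finset.ne_of_mem_erase hi)]
  rw [expectation_substitute, ← Finset.add_sum_erase _ _ (Finset.mem_univ (0 : Fin d)), h0,
    ← Finset.add_sum_erase _ (fun i => fidelity (basisVector e i) η * fidelity (basisVector e i) η)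
      (Finset.mem_univ (0 : Fin d)), hs]
  have h1 := P.prob_add_prob_compl ψ η
  rw [← hS] at h1
  set p := P.prob Outcome.accept ψ η
  set p' := expectation (toPure η) P.steps (Set.indicator Sᶜ 1) (initial P.initA P.initB ψ)
  set f := fidelity (basisVector e 0) η
  calc _ = p * (f * fidelity h η) + ((p + p') * (f * f) + ∑ i ∈ Finset.univ.erase (0 : Fin d),
        fidelity (basisVector e i) η * fidelity (basisVector e i) η) := by ring
    _ = _ := by rw [h1, one_mul]

/-- The average over η of ∑ᵢ F(eᵢ, η)² is d · 2/(d(d+1)) = 2/(d+1): the score of the attack without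
the switch. -/
theorem score_substitute_add (e : OrthonormalBasis (Fin d) ℂ (EuclideanSpace ℂ (Fin d)))
    (h ψ : UnitVector d) :
    (P.substitute e h ψ).score + ∫⁻ η, P.prob Outcome.accept ψ η *
        (fidelity (basisVector e 0) η * fidelity (basisVector e 0) η) ∂uniform d =
      ∫⁻ η, P.prob Outcome.accept ψ η * (fidelity (basisVector e 0) η * fidelity h η) ∂uniform d +
        ENNReal.ofReal (2 / (d + 1)) := by
  have hd : (d : ℝ) ≠ 0 := Nat.cast_ne_zero.2 (NeZero.ne d)
  have hfid : ∀ g : UnitVector d, Measurable fun η => fidelity g η := fun g =>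
    Measurable.comp (g := fun p : UnitVector d × UnitVector d => fidelity p.1 p.2)
      (f := fun η => (g, η)) measurable_fidelity measurable_prodMk_left
  have hp : Measurable fun η => P.prob Outcome.accept ψ η :=
    (P.measurable_prob Outcome.accept).comp measurable_prodMk_left
  have hff : ∀ g h : UnitVector d, Measurable fun η => fidelity g η * fidelity h η := fun g h =>
    (hfid g).mul (hfid h)
  have hpff : ∀ g h : UnitVector d, Measurable fun η =>
      P.prob Outcome.accept ψ η * (fidelity g η * fidelity h η) := fun g h => hp.mul (hff g h)
  rw [BobStrategy.score, ← lintegral_add_right _ (hpff _ _)]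
  simp_rw [P.expectation_substitute_add]
  rw [lintegral_add_left (hpff _ _), lintegral_finsetSum _ fun i _ => hff _ _]
  simp_rw [uniform_fidelity_sq]
  rw [Finset.sum_const, Finset.card_univ, Fintype.card_fin, nsmul_eq_mul,
    ← ENNReal.ofReal_natCast, ← ENNReal.ofReal_mul (by positivity)]
  congr 2
  field_simp

/-- If the protocol does not help Bob, then the overlaps of the state with a pair of guesses,
weighted with the probability of acceptance, are dominated by the diagonal. -/
theorem weighted_fourth_moment_le (hK : P.epsilonK ≤ ENNReal.ofReal (2 / (d + 1)))
    (g h ψ : UnitVector d) :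
    ∫⁻ η, P.prob Outcome.accept ψ η * (fidelity g η * fidelity h η) ∂uniform d ≤
      ∫⁻ η, P.prob Outcome.accept ψ η * (fidelity g η * fidelity g η) ∂uniform d := by
  obtain ⟨e, he⟩ := exists_orthonormalBasis_apply_zero g
  have hg : basisVector e 0 = g := Subtype.ext he
  have h1 := P.score_substitute_add e h ψ
  have h2 : (P.substitute e h ψ).score ≤ ENNReal.ofReal (2 / (d + 1)) := (le_iSup _ _).trans hK
  rw [hg] at h1
  refine (ENNReal.add_le_add_iff_right ENNReal.ofReal_ne_top).1
    (h1.symm.le.trans ((add_le_add_left h2 _).trans_eq (add_comm _ _)))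

theorem lintegral_prob_mul_fidelity (hK : P.epsilonK ≤ ENNReal.ofReal (2 / (d + 1)))
    (ψ : UnitVector d) :
    d * ∫⁻ η, P.prob Outcome.accept ψ η * fidelity ψ η ∂uniform d =
      ∫⁻ η, P.prob Outcome.accept ψ η ∂uniform d := by
  have hp : Measurable fun η => P.prob Outcome.accept ψ η :=
    (P.measurable_prob Outcome.accept).comp measurable_prodMk_left
  -- Up to normalization, ν is the posterior of η after an accepting run on the substitute ψ. The
  -- guess vector at which its second moment is evaluated below is ψ itself.
  set ν := (uniform d).withDensity fun η => P.prob Outcome.accept ψ η with hν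
  have hle : ∫⁻ η, P.prob Outcome.accept ψ η ∂uniform d ≤ 1 := by
    refine (lintegral_mono fun η => P.prob_le_one ψ η).trans ?_
    simp
  have : IsFiniteMeasure ν :=
    isFiniteMeasure_withDensity (hle.trans_lt ENNReal.one_lt_top).ne
  have hint : ∀ f : UnitVector d → ℝ, Continuous f → (∀ η, 0 ≤ f η) →
      ENNReal.ofReal (∫ η, f η ∂ν) =
        ∫⁻ η, P.prob Outcome.accept ψ η * ENNReal.ofReal (f η) ∂uniform d := by
    intro f hf h0
    have hfm : Measurable fun η => ENNReal.ofReal (f η) :=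
      ENNReal.measurable_ofReal.comp hf.measurable
    rw [ofReal_integral_eq_lintegral_ofReal (integrable_of_continuous_sphere hf ν)
      (ae_of_all _ h0), hν, lintegral_withDensity_eq_lintegral_mul _ hp hfm]
    rfl
  have hB : ∀ g h : UnitVector d, ∫ η, ‖inner ℂ g.1 η.1‖ ^ 2 * ‖inner ℂ h.1 η.1‖ ^ 2 ∂ν ≤
      ∫ η, ‖inner ℂ g.1 η.1‖ ^ 4 ∂ν := by
    intro g h
    have h1 := P.weighted_fourth_moment_le hK g h ψ
    simp_rw [fidelity_eq_ofReal, ← ENNReal.ofReal_mul (sq_nonneg _)] at h1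
    rw [← hint _ (by fun_prop) (fun _ => by positivity),
      ← hint _ (by fun_prop) (fun _ => by positivity),
      ENNReal.ofReal_le_ofReal_iff (integral_nonneg fun _ => by positivity)] at h1
    refine h1.trans_eq (integral_congr_ae (ae_of_all _ fun η => ?_))
    ring
  have h2 := congrArg ENNReal.ofReal (second_moment_of_diag_max ν hB ψ)
  rw [ENNReal.ofReal_mul (by positivity), ENNReal.ofReal_natCast,
    hint _ (by fun_prop) (fun _ => by positivity), ofReal_measureReal (measure_ne_top _ _), hν,
    withDensity_apply _ MeasurableSet.univ, Measure.restrict_univ] at h2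
  simp_rw [fidelity_eq_ofReal]
  exact h2

/-- If the protocol does not help Bob, then honest Alice is accepted no more often than one who
pretends to know an independent random state. -/
theorem lintegral_prob_diag (hK : P.epsilonK ≤ ENNReal.ofReal (2 / (d + 1))) :
    ∫⁻ η, P.prob Outcome.accept η η ∂uniform d =
      ∫⁻ η, ∫⁻ ψ, P.prob Outcome.accept ψ η ∂uniform d ∂uniform d := by
  have hm := P.measurable_prob Outcome.accept
  have hmF : Measurable fun p : UnitVector d × UnitVector d =>
      P.prob Outcome.accept p.1 p.2 * fidelity p.1 p.2 := hm.mul measurable_fidelity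
  have hsw : Measurable fun p : UnitVector d × UnitVector d => P.prob Outcome.accept p.2 p.1 :=
    hm.comp measurable_swap
  have hswF : Measurable fun p : UnitVector d × UnitVector d =>
      P.prob Outcome.accept p.2 p.1 * fidelity p.2 p.1 := hmF.comp measurable_swap
  have hsw' : Measurable fun η => ∫⁻ ψ, P.prob Outcome.accept ψ η ∂uniform d :=
    hsw.lintegral_prod_right'
  have hswF' : Measurable fun η =>
      ∫⁻ ψ, P.prob Outcome.accept ψ η * fidelity ψ η ∂uniform d := hswF.lintegral_prod_right'
  -- This side fixes ψ and averages over Alice's η, using the rigidity of the moments.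
  have h1 : d * ∫⁻ η, ∫⁻ ψ, P.prob Outcome.accept ψ η * fidelity ψ η ∂uniform d ∂uniform d =
      ∫⁻ η, ∫⁻ ψ, P.prob Outcome.accept ψ η ∂uniform d ∂uniform d := by
    rw [lintegral_lintegral_swap (f := fun η ψ => P.prob Outcome.accept ψ η * fidelity ψ η)
      hswF.aemeasurable, lintegral_lintegral_swap (f := fun η ψ => P.prob Outcome.accept ψ η)
      hsw.aemeasurable,
      ← lintegral_const_mul _ hmF.lintegral_prod_right']
    exact lintegral_congr fun ψ => P.lintegral_prob_mul_fidelity hK ψ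
  -- This side fixes η and averages over Bob's ψ, using that acceptance is a quadratic form in ψ.
  have h2 : d * (d + 1) *
      ∫⁻ η, ∫⁻ ψ, P.prob Outcome.accept ψ η * fidelity ψ η ∂uniform d ∂uniform d =
      d * ∫⁻ η, ∫⁻ ψ, P.prob Outcome.accept ψ η ∂uniform d ∂uniform d +
        ∫⁻ η, P.prob Outcome.accept η η ∂uniform d := by
    rw [← lintegral_const_mul _ hswF', ← lintegral_const_mul _ hsw',
      ← lintegral_add_left (hsw'.const_mul _)]
    exact lintegral_congr fun η => (P.hasDesignIdentity_prob Outcome.accept η).2 η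
  have hfin : ∫⁻ η, ∫⁻ ψ, P.prob Outcome.accept ψ η ∂uniform d ∂uniform d ≠ ∞ := by
    refine ne_top_of_le_ne_top ENNReal.one_ne_top
      ((lintegral_mono fun η => lintegral_mono fun ψ => P.prob_le_one ψ η).trans ?_)
    simp
  -- With X the average over independent ψ and η, this reads dX + X = dX + ∫ p(η; η) dη, and dX is
  -- finite.
  rw [mul_comm (d : ℝ≥0∞), mul_assoc, h1, add_mul, one_mul] at h2
  exact ((ENNReal.add_right_inj (ENNReal.mul_ne_top (ENNReal.natCast_ne_top d) hfin)).1 h2).symm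

end Protocol

end Estimate

end KCEKQS

theorem theorem1 (d : ℕ) [NeZero d] (P : KCEKQS.Protocol d) (hP : P.NonTrivial) :
    ¬ P.ZeroKnowledge ∧ KCEKQS.epsilonM d < P.epsilonK := by
  have hlt : KCEKQS.epsilonM d < P.epsilonK := by
    -- The value 2/(d+1) separates the two quantities; only the upper bound on `epsilonM` is needed.
    refine (KCEKQS.epsilonM_le d).trans_lt (lt_of_not_ge fun hK => ?_)
    refine absurd hP (not_lt_of_ge ?_)
    rw [KCEKQS.Protocol.epsilonC]
    refine tsub_tsub_le.trans ?_
    rw [P.lintegral_prob_diag hK]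
    -- An average over η of scores of pretending strategies cannot exceed their supremum.
    refine (MeasureTheory.lintegral_mono fun η => P.lintegral_prob_le_epsilonS η).trans ?_
    simp
  exact ⟨fun h => hlt.ne h.symm, hlt⟩
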